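/- **Theorem (Caccioppoli estimate).** Let $n,N\in\mathbb N$. *Assumption on $\varphi$.* $\varphi:[0,\infty)\to[0,\infty)$ is an N-function, i.e. $\varphi(0)=0$ and $\varphi$ has a derivative $\varphi'$ that is right continuous and non-decreasing with $\varphi'(0)=0$, $\varphi'(t)>0$ for $t>0$ and $\lim_{t\to\infty}\varphi'(t)=\infty$. Moreover $\varphi\in C^1([0,\infty))\cap C^2((0,\infty))$ and $c_0\,t\varphi''(t)\le\varphi'(t)\le c_1\,t\varphi''(t)$ for all $t>0$, with constants $c_0,c_1>0$ (the characteristics of $\varphi$). For $a,t\ge0$ put $$\varphi_a(t):=\int_0^t\varphi'(a+s)\,\frac{s}{a+s}\,ds .$$ *Assumptions on $f$.* Let $\Omega\subset\mathbb R^n$ be open and let $|\cdot|$ be the Euclidean norm on $\mathbb R^N$ and $\mathbb R^{N\times n}$. The function $f:\mathbb R^{N\times n}\to\mathbb R$ satisfies, for some constants $k>0$, $K$ and $L$: 1. $f\in C^1(\mathbb R^{N\times n})\cap C^2(\mathbb R^{N\times n}\setminus\{0\})$; 2. $|f(Q)|\le K\varphi(|Q|)$ for all $Q$; 3. for every ball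 $B\subset\Omega$, every $Q$ and every $w\in C^1(\mathbb R^n,\mathbb R^N)$ with compact support in $B$, $$\int_B \big(f(Q+\nabla w)-f(Q)\big)\,dx\ \ge\ k\int_B\varphi_{|Q|}(|\nabla w|)\,dx;$$ 4. $|D^2f(Q)|\le L\,\varphi''(|Q|)$ for all $Q\ne0$, where $|D^2 f(Q)|$ is the operator norm; 5. for some $\beta\in(0,1]$ and some constant $C$, $|D^2f(Q)-D^2f(Q+P)|\le C\varphi''(|Q|)|Q|^{-\beta}|P|^\beta$ for all $P$ and all $Q\neq 0$ with $|P|\le\frac12|Q|$. *Local minimizers.* $W^{1,\varphi}_{loc}(\Omega)$ denotes the set of weakly differentiable $u:\Omega\to\mathbb R^N$ (with $u,\nabla u\in L^1_{loc}(\Omega)$) such that $\varphi(|u|)$ and $\varphi(|\nabla u|)$ are integrable on every compact subset of $\Omega$. A function $u\in W^{1,\varphi}_{loc}(\Omega)$ is a local minimizer of $\mathcal F(u)=\int_\Omega f(\nabla u)\,dx$ if $\int_S f(\nabla u)\,dx\le\int_S f(\nabla v)\,dx$ for every compact $S\subset\Omega$ and every $v\in W^{1,\varphi}_{loc}(\Omega)$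 with $v=u$ a.e. in $\Omega\setminus S$. *Conclusion.* There is a constant $c>0$ that depends only on $n,N,k,K,L$ and $c_0,c_1$ such that the following holds for all $\varphi,\Omega,f$ as above. If $u\in W^{1,\varphi}_{loc}(\Omega)$ is a local minimizer of $\mathcal F$ and $B$ is a ball of radius $R>0$ such that the closure of $2B$, the ball with the same center and radius $2R$, is contained in $\Omega$, then $$\int_B\varphi_{|Q|}(|\nabla u-Q|)\,dx\ \le\ c\int_{2B}\varphi_{|Q|}\Big(\frac{|u-q|}{R}\Big)\,dx$$ for all $Q\in\mathbb R^{N\times n}$ and all $q(x)=Qx+b$ with $b\in\mathbb R^N$, and both integrals are finite. -/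

import Mathlib

open MeasureTheory Set Filter Topology
open scoped ContDiff

/-- The space `ℝⁿ` with its Euclidean norm. -/
abbrev Vec (n : ℕ) : Type := EuclideanSpace ℝ (Fin n)

/-- The space `ℝ^{N × n}` of matrices with the Euclidean (Frobenius) norm. -/
abbrev Mat (N n : ℕ) : Type := EuclideanSpace ℝ (Fin N × Fin n)

noncomputable section

/-! ### N-functions

A function on `[0, ∞)` is represented by a map `ℝ → ℝ`, of which only the values on
`[0, ∞)` are ever used. -/

/-- The derivative `φ'` on `[0, ∞)` (one-sided at `0`). -/
def phiDeriv (φ : ℝ → ℝ) (t : ℝ) : ℝ := derivWithin φ (Ici 0) t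

/-- The second derivative `φ''`, used only on `(0, ∞)`. -/
def phiDeriv2 (φ : ℝ → ℝ) (t : ℝ) : ℝ := deriv (phiDeriv φ) t

/-- N-functions. -/
structure IsNFunction (φ : ℝ → ℝ) : Prop where
  map_zero : φ 0 = 0
  differentiableOn : DifferentiableOn ℝ φ (Ici 0)
  right_continuous : ∀ t, 0 ≤ t → ContinuousWithinAt (phiDeriv φ) (Ici t) t
  monotoneOn : MonotoneOn (phiDeriv φ) (Ici 0)
  deriv_zero : phiDeriv φ 0 = 0
  deriv_pos : ∀ t, 0 < t → 0 < phiDeriv φ t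
  tendsto_deriv : Tendsto (phiDeriv φ) atTop atTop

/-- The standing assumption on `φ`: it is an N-function, `C¹` on `[0, ∞)` and `C²` on `(0, ∞)`,
and `φ'(t) ∼ t φ''(t)` uniformly in `t > 0`.  The constants `c₀`, `c₁` in this equivalence are
the characteristics of `φ`. -/
structure IsRegularNFunction (φ : ℝ → ℝ) (c₀ c₁ : ℝ) : Prop where
  isNFunction : IsNFunction φ
  contDiffOn_one : ContDiffOn ℝ 1 φ (Ici 0)
  contDiffOn_two : ContDiffOn ℝ 2 φ (Ioi 0)
  lower : ∀ t, 0 < t → c₀ * (t * phiDeriv2 φ t) ≤ phiDeriv φ t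
  upper : ∀ t, 0 < t → phiDeriv φ t ≤ c₁ * (t * phiDeriv2 φ t)

/-- The shifted N-function `φ_a(t) = ∫₀ᵗ φ'(a + s) s / (a + s) ds`. -/
def shifted (φ : ℝ → ℝ) (a t : ℝ) : ℝ :=
  ∫ s in (0 : ℝ)..t, phiDeriv φ (a + s) * (s / (a + s))

/-! ### The integrand -/

/-- The classical gradient of `w : ℝⁿ → ℝᴺ`: the matrix of the partial derivatives `∂ⱼ wᵢ`. -/
def grad {n N : ℕ} (w : Vec n → Vec N) (x : Vec n) : Mat N n :=
  WithLp.toLp 2 fun p => (fderiv ℝ w x (EuclideanSpace.single p.2 1)) p.1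

/-- Strict `W^{1,φ}`-quasiconvexity of `f` with constant `k`, on the balls contained in `Ω`.
The test functions are the `C¹` maps with compact support in the ball. -/
def StrictlyQuasiconvex {n N : ℕ} (Ω : Set (Vec n)) (φ : ℝ → ℝ) (f : Mat N n → ℝ) (k : ℝ) :
    Prop :=
  ∀ (x : Vec n) (r : ℝ), 0 < r → Metric.ball x r ⊆ Ω → ∀ (Q : Mat N n) (w : Vec n → Vec N),
    ContDiff ℝ 1 w → HasCompactSupport w → tsupport w ⊆ Metric.ball x r →
      k * ∫ y in Metric.ball x r, shifted φ ‖Q‖ ‖grad w y‖ ≤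
        ∫ y in Metric.ball x r, (f (Q + grad w y) - f Q)

/-- The structure conditions on the integrand `f : ℝ^{N × n} → ℝ`: regularity, growth with
constant `K`, strict quasiconvexity with constant `k`, the bound for `D²f` with constant `L`,
and Hölder continuity of `D²f` away from `0` with some exponent and some constant. -/
structure IsAdmissibleIntegrand {n N : ℕ} (Ω : Set (Vec n)) (φ : ℝ → ℝ) (f : Mat N n → ℝ)
    (k K L : ℝ) : Prop where
  contDiff_one : ContDiff ℝ 1 f
  contDiffOn_two : ContDiffOn ℝ 2 f {0}ᶜ
  growth : ∀ Q : Mat N n, |f Q| ≤ K * φ ‖Q‖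
  quasiconvex : StrictlyQuasiconvex Ω φ f k
  hessian_bound : ∀ Q : Mat N n, Q ≠ 0 → ‖fderiv ℝ (fderiv ℝ f) Q‖ ≤ L * phiDeriv2 φ ‖Q‖
  hessian_holder : ∃ β : ℝ, 0 < β ∧ β ≤ 1 ∧ ∃ C : ℝ, ∀ P Q : Mat N n, Q ≠ 0 → ‖P‖ ≤ ‖Q‖ / 2 →
    ‖fderiv ℝ (fderiv ℝ f) Q - fderiv ℝ (fderiv ℝ f) (Q + P)‖ ≤
      C * phiDeriv2 φ ‖Q‖ * ‖Q‖ ^ (-β) * ‖P‖ ^ β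

/-! ### Sobolev-Orlicz functions and local minimizers -/

/-- `G` is the weak gradient of `u` in the open set `Ω`, both being locally integrable there. -/
structure HasWeakGradient {n N : ℕ} (Ω : Set (Vec n)) (u : Vec n → Vec N) (G : Vec n → Mat N n) :
    Prop where
  locallyIntegrableOn : LocallyIntegrableOn u Ω volume
  locallyIntegrableOn_grad : LocallyIntegrableOn G Ω volume
  integral_eq : ∀ η : Vec n → ℝ, ContDiff ℝ ∞ η → HasCompactSupport η → tsupport η ⊆ Ω →
    ∀ (i : Fin N) (j : Fin n),
      ∫ x in Ω, u x i * fderiv ℝ η x (EuclideanSpace.single j 1) = -∫ x in Ω, G x (i, j) * η x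

/-- `u ∈ W^{1,φ}_loc(Ω)` with weak gradient `G`: the modulars of `u` and of `G` are finite on
every compact subset of `Ω`. -/
structure MemSobolevOrliczLoc {n N : ℕ} (Ω : Set (Vec n)) (φ : ℝ → ℝ) (u : Vec n → Vec N)
    (G : Vec n → Mat N n) : Prop where
  hasWeakGradient : HasWeakGradient Ω u G
  integrableOn : ∀ S : Set (Vec n), IsCompact S → S ⊆ Ω →
    IntegrableOn (fun x => φ ‖u x‖) S volume
  integrableOn_grad : ∀ S : Set (Vec n), IsCompact S → S ⊆ Ω →
    IntegrableOn (fun x => φ ‖G x‖) S volume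

/-- `u ∈ W^{1,φ}_loc(Ω)`, with weak gradient `G`, is a local minimizer of `v ↦ ∫_Ω f(∇v) dx`:
its energy on a compact set `S ⊆ Ω` does not exceed the energy on `S` of any
`v ∈ W^{1,φ}_loc(Ω)` that agrees with `u` outside `S`.  (Under the growth condition on `f` both
energies are finite.) -/
structure IsLocalMinimizer {n N : ℕ} (Ω : Set (Vec n)) (φ : ℝ → ℝ) (f : Mat N n → ℝ)
    (u : Vec n → Vec N) (G : Vec n → Mat N n) : Prop where
  mem : MemSobolevOrliczLoc Ω φ u G
  minimal : ∀ S : Set (Vec n), IsCompact S → S ⊆ Ω →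
    ∀ (v : Vec n → Vec N) (H : Vec n → Mat N n), MemSobolevOrliczLoc Ω φ v H →
      (∀ᵐ x ∂(volume.restrict (Ω \ S)), v x = u x) →
        ∫ x in S, f (G x) ≤ ∫ x in S, f (H x)

/-- The linear polynomial `q(x) = Q x + b` on `ℝⁿ` with values in `ℝᴺ`; its gradient is `Q`. -/
def linPoly {n N : ℕ} (Q : Mat N n) (b : Vec N) (x : Vec n) : Vec N :=
  WithLp.toLp 2 fun i => (∑ j, Q (i, j) * x j) + b i

end

/-! Fix radii `R ≤ s < t ≤ 2R` and a cutoff `η` equal to 1 on `B_s` and supported inside `B_t`. Put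
`w = u - q` and split `∇u - Q = X + Y` with `X = ∇(ηw)` and `Y = ∇((1-η)w)`. Strict quasiconvexity
at `Q`, tested with `ηw`, bounds `k ∫ φ_{|Q|}(|X|)` by `∫ (f(Q+X) - f(Q))`. Minimality against the
competitor `u - ηw` gives `∫ f(Q+X+Y) ≤ ∫ f(Q+Y)`. The sum of both is controlled by the integral of
the second difference `f(Q+X) - f(Q) - f(Q+X+Y) + f(Q+Y)`, which vanishes on `B_s` because `Y = 0`
there.

The linear terms of the second difference cancel, and the Hessian bound leaves at most a multiple of
`φ_{|Q|}'(|X|+|Y|) |Y|` (`norm_fderiv_add_sub_le`, `second_difference_le`). Since `φ_{|Q|}` grows at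
most like a power, uniformly in `Q`, this is bounded by `φ_{|Q|}(|∇u-Q|) + φ_{|Q|}(|w|/(t-s))` up to
a constant. Hence the energy on `B_s` is at most a constant times the energy on the annulus `B_t \
B_s` plus the wanted term (`hole_filling`). Adding the missing multiple of the energy on `B_s` to
both sides produces a factor `θ < 1` in front of the energy on `B_t`, and `exists_iteration_bound`
absorbs that term.

Quasiconvexity is assumed for `C¹` test functions only; `quasiconvex_weak` carries it over to `ηw`
by mollification, Jensen's inequality and Fatou's lemma. -/

/-! ### N-functions and their shifts: growth estimates uniform in the shift. -/

section NFunction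

variable {φ : ℝ → ℝ} {c₀ c₁ : ℝ}

theorem IsRegularNFunction.continuousOn_phiDeriv (hφ : IsRegularNFunction φ c₀ c₁) :
    ContinuousOn (phiDeriv φ) (Ici 0) :=
  hφ.contDiffOn_one.continuousOn_derivWithin (uniqueDiffOn_Ici 0) le_rfl

theorem IsNFunction.phiDeriv_nonneg (hφ : IsNFunction φ) {t : ℝ} (ht : 0 ≤ t) :
    0 ≤ phiDeriv φ t := by
  rcases ht.eq_or_lt with rfl | h
  · exact hφ.deriv_zero.ge
  · exact (hφ.deriv_pos t h).le

theorem phiDeriv_eq_deriv {t : ℝ} (ht : 0 < t) : phiDeriv φ t = deriv φ t :=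
  derivWithin_of_mem_nhds (Ici_mem_nhds ht)

theorem IsNFunction.hasDerivAt (hφ : IsNFunction φ) {t : ℝ} (ht : 0 < t) :
    HasDerivAt φ (phiDeriv φ t) t := by
  rw [phiDeriv_eq_deriv ht]
  exact ((hφ.differentiableOn t ht.le).differentiableAt (Ici_mem_nhds ht)).hasDerivAt

theorem IsRegularNFunction.hasDerivAt_phiDeriv (hφ : IsRegularNFunction φ c₀ c₁) {t : ℝ}
    (ht : 0 < t) : HasDerivAt (phiDeriv φ) (phiDeriv2 φ t) t := by
  have h1 : ContDiffOn ℝ 1 (deriv φ) (Ioi 0) :=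
    hφ.contDiffOn_two.deriv_of_isOpen isOpen_Ioi (by norm_num)
  have h2 : DifferentiableAt ℝ (deriv φ) t :=
    (h1.differentiableOn one_ne_zero t ht).differentiableAt (Ioi_mem_nhds ht)
  have h3 : phiDeriv φ =ᶠ[𝓝 t] deriv φ := by
    filter_upwards [Ioi_mem_nhds ht] with s hs using phiDeriv_eq_deriv hs
  exact (h2.congr_of_eventuallyEq h3).hasDerivAt

/-- The derivative of a regular N-function grows at most polynomially. -/
theorem IsRegularNFunction.phiDeriv_mul_le (hφ : IsRegularNFunction φ c₀ c₁) {m : ℕ}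
    (hm : 1 ≤ m * c₀) {l t : ℝ} (hl : 1 ≤ l) (ht : 0 ≤ t) :
    phiDeriv φ (l * t) ≤ l ^ m * phiDeriv φ t := by
  rcases ht.eq_or_lt with rfl | ht
  · simp [hφ.isNFunction.deriv_zero]
  have hd : ∀ s : ℝ, 0 < s → HasDerivAt (fun s => phiDeriv φ s / s ^ m)
      ((phiDeriv2 φ s * s ^ m - phiDeriv φ s * (m * s ^ (m - 1))) / (s ^ m) ^ 2) s := fun s hs =>
    (hφ.hasDerivAt_phiDeriv hs).div (hasDerivAt_pow m s) (pow_pos hs m).ne'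
  -- The quotient `φ'(s)/s^m` decreases because `s φ''(s) ≤ φ'(s)/c₀ ≤ m φ'(s)`; comparing its
  -- values at `t` and `l t` gives the claim.
  have hanti : AntitoneOn (fun s => phiDeriv φ s / s ^ m) (Ioi 0) := by
    apply antitoneOn_of_deriv_nonpos (convex_Ioi 0)
    · exact fun s hs => (hd s hs).continuousAt.continuousWithinAt
    · rw [interior_Ioi]
      exact fun s hs => (hd s hs).differentiableAt.differentiableWithinAt
    · rw [interior_Ioi]
      intro s hs
      have hs' : 0 < s := hs
      rw [(hd s hs).deriv]
      apply div_nonpos_of_nonpos_of_nonneg _ (by positivity)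
      have hm0 : m ≠ 0 := by rintro rfl; norm_num at hm
      obtain ⟨j, rfl⟩ := Nat.exists_eq_succ_of_ne_zero hm0
      have h1 := hφ.lower s hs
      have hp := hφ.isNFunction.deriv_pos s hs
      have h2 : s * phiDeriv2 φ s ≤ (j + 1 : ℕ) * phiDeriv φ s := by
        by_cases h0 : 0 ≤ s * phiDeriv2 φ s
        · calc s * phiDeriv2 φ s ≤ ((j + 1 : ℕ) * c₀) * (s * phiDeriv2 φ s) :=
                le_mul_of_one_le_left h0 hm
            _ = (j + 1 : ℕ) * (c₀ * (s * phiDeriv2 φ s)) := by ring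
            _ ≤ _ := by gcongr
        · push Not at h0
          exact h0.le.trans (by positivity)
      have h3 : 0 < s ^ j := pow_pos hs' j
      simp only [Nat.succ_eq_add_one, Nat.add_sub_cancel] at *
      rw [pow_succ]
      nlinarith
  have hlt : t ≤ l * t := le_mul_of_one_le_left ht.le hl
  have h := hanti (show t ∈ Ioi 0 from ht) (show l * t ∈ Ioi 0 from ht.trans_le hlt) hlt
  simp only at h
  have h0 : 0 < l := by linarith
  rw [div_le_div_iff₀ (by positivity) (by positivity), mul_pow] at h
  have h3 : 0 < t ^ m := pow_pos ht m
  refine le_of_mul_le_mul_right ?_ h3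
  linarith

/-- The derivative `φ_a'` of the shifted N-function `φ_a`. -/
noncomputable def shiftedDeriv (φ : ℝ → ℝ) (a t : ℝ) : ℝ := phiDeriv φ (a + t) * (t / (a + t))

/-- This includes `a = 0`, where the quotient `0/0` has the default value 0, in agreement with
`φ'(0) = 0`. -/
theorem shiftedDeriv_zero (φ : ℝ → ℝ) (a : ℝ) : shiftedDeriv φ a 0 = 0 := by simp [shiftedDeriv]

theorem IsNFunction.shiftedDeriv_nonneg (hφ : IsNFunction φ) {a t : ℝ} (ha : 0 ≤ a)
    (ht : 0 ≤ t) : 0 ≤ shiftedDeriv φ a t :=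
  mul_nonneg (hφ.phiDeriv_nonneg (by positivity)) (by positivity)

theorem IsNFunction.shiftedDeriv_mono (hφ : IsNFunction φ) {a s t : ℝ} (ha : 0 ≤ a)
    (hs : 0 ≤ s) (hst : s ≤ t) : shiftedDeriv φ a s ≤ shiftedDeriv φ a t := by
  rcases hs.eq_or_lt with rfl | hs
  · rw [shiftedDeriv_zero]; exact hφ.shiftedDeriv_nonneg ha hst
  have ht : 0 < t := hs.trans_le hst
  have h1 : phiDeriv φ (a + s) ≤ phiDeriv φ (a + t) :=
    hφ.monotoneOn (by simp; positivity) (by simp; positivity) (by linarith)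
  have h2 : s / (a + s) ≤ t / (a + t) := by
    rw [div_le_div_iff₀ (by positivity) (by positivity)]
    nlinarith
  exact mul_le_mul h1 h2 (by positivity) (hφ.phiDeriv_nonneg (by positivity))

theorem IsNFunction.shiftedDeriv_monotoneOn (hφ : IsNFunction φ) {a : ℝ} (ha : 0 ≤ a) :
    MonotoneOn (shiftedDeriv φ a) (Ici 0) :=
  fun _ hs _ _ hst => hφ.shiftedDeriv_mono ha hs hst

/-- Since `a + l t ≤ l (a + t)`, the factor `φ'` costs `l^m`, and the quotient `t/(a+t)` costs one
more `l`. The bound does not see `a`, which is what makes the final constant independent of `Q`. -/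
theorem IsRegularNFunction.shiftedDeriv_mul_le (hφ : IsRegularNFunction φ c₀ c₁) {m : ℕ}
    (hm : 1 ≤ m * c₀) {a l t : ℝ} (ha : 0 ≤ a) (hl : 1 ≤ l) (ht : 0 ≤ t) :
    shiftedDeriv φ a (l * t) ≤ l ^ (m + 1) * shiftedDeriv φ a t := by
  rcases ht.eq_or_lt with rfl | ht
  · simp [shiftedDeriv_zero]
  have hlt : t ≤ l * t := le_mul_of_one_le_left ht.le hl
  have hla : a ≤ l * a := le_mul_of_one_le_left ha hl
  have h0 : 0 < l := by linarith
  have h1 : phiDeriv φ (a + l * t) ≤ l ^ m * phiDeriv φ (a + t) := by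
    refine le_trans ?_ (hφ.phiDeriv_mul_le hm hl (by positivity))
    exact hφ.isNFunction.monotoneOn (by simp; positivity) (by simp; positivity) (by linarith)
  have h2 : l * t / (a + l * t) ≤ l * (t / (a + t)) := by
    rw [mul_div_assoc']
    gcongr
  calc shiftedDeriv φ a (l * t) ≤ (l ^ m * phiDeriv φ (a + t)) * (l * (t / (a + t))) :=
        mul_le_mul h1 h2 (by positivity)
          (mul_nonneg (by positivity) (hφ.isNFunction.phiDeriv_nonneg (by positivity)))
    _ = l ^ (m + 1) * shiftedDeriv φ a t := by rw [shiftedDeriv]; ring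

theorem IsNFunction.intervalIntegrable_shiftedDeriv (hφ : IsNFunction φ) {a s t : ℝ} (ha : 0 ≤ a)
    (hs : 0 ≤ s) (ht : 0 ≤ t) : IntervalIntegrable (shiftedDeriv φ a) volume s t := by
  apply MonotoneOn.intervalIntegrable
  exact (hφ.shiftedDeriv_monotoneOn ha).mono fun x hx => (le_min hs ht).trans hx.1

theorem shifted_eq (φ : ℝ → ℝ) (a t : ℝ) :
    shifted φ a t = ∫ s in (0 : ℝ)..t, shiftedDeriv φ a s := rfl

theorem shifted_zero (φ : ℝ → ℝ) (a : ℝ) : shifted φ a 0 = 0 := by simp [shifted]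

theorem IsNFunction.shifted_sub (hφ : IsNFunction φ) {a s t : ℝ} (ha : 0 ≤ a)
    (hs : 0 ≤ s) (ht : 0 ≤ t) :
    shifted φ a t - shifted φ a s = ∫ r in s..t, shiftedDeriv φ a r := by
  rw [shifted_eq, shifted_eq, intervalIntegral.integral_interval_sub_left] <;>
    exact hφ.intervalIntegrable_shiftedDeriv ha le_rfl ‹_›

theorem IsNFunction.mul_shiftedDeriv_le_shifted_sub (hφ : IsNFunction φ) {a s t : ℝ} (ha : 0 ≤ a)
    (hs : 0 ≤ s) (hst : s ≤ t) :
    (t - s) * shiftedDeriv φ a s ≤ shifted φ a t - shifted φ a s := by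
  rw [hφ.shifted_sub ha hs (hs.trans hst)]
  have := intervalIntegral.integral_mono_on (μ := volume) hst
    (intervalIntegrable_const (c := shiftedDeriv φ a s))
    (hφ.intervalIntegrable_shiftedDeriv ha hs (hs.trans hst))
    (fun x hx => hφ.shiftedDeriv_mono ha hs hx.1)
  simpa using this

theorem IsNFunction.shifted_sub_le_mul_shiftedDeriv (hφ : IsNFunction φ) {a s t : ℝ} (ha : 0 ≤ a)
    (hs : 0 ≤ s) (hst : s ≤ t) :
    shifted φ a t - shifted φ a s ≤ (t - s) * shiftedDeriv φ a t := by
  rw [hφ.shifted_sub ha hs (hs.trans hst)]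
  have := intervalIntegral.integral_mono_on (μ := volume) hst
    (hφ.intervalIntegrable_shiftedDeriv ha hs (hs.trans hst))
    (intervalIntegrable_const (c := shiftedDeriv φ a t))
    (fun x hx => hφ.shiftedDeriv_mono ha (hs.trans hx.1) hx.2)
  simpa using this

/-- The tangent line inequality for the convex function `φ_a`. -/
theorem IsNFunction.shifted_tangent_le (hφ : IsNFunction φ) {a s t : ℝ} (ha : 0 ≤ a)
    (hs : 0 ≤ s) (ht : 0 ≤ t) :
    shifted φ a s + shiftedDeriv φ a s * (t - s) ≤ shifted φ a t := by
  rcases le_total s t with h | h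
  · linarith [hφ.mul_shiftedDeriv_le_shifted_sub ha hs h]
  · linarith [hφ.shifted_sub_le_mul_shiftedDeriv ha ht h]

theorem IsNFunction.shifted_mono (hφ : IsNFunction φ) {a s t : ℝ} (ha : 0 ≤ a)
    (hs : 0 ≤ s) (hst : s ≤ t) : shifted φ a s ≤ shifted φ a t := by
  have h1 := hφ.mul_shiftedDeriv_le_shifted_sub ha hs hst
  have h2 := mul_nonneg (sub_nonneg.2 hst) (hφ.shiftedDeriv_nonneg ha hs)
  linarith

theorem IsNFunction.shifted_nonneg (hφ : IsNFunction φ) {a t : ℝ} (ha : 0 ≤ a) (ht : 0 ≤ t) :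
    0 ≤ shifted φ a t := by
  simpa [shifted_zero] using hφ.shifted_mono ha le_rfl ht

theorem IsNFunction.shifted_le (hφ : IsNFunction φ) {a t : ℝ} (ha : 0 ≤ a) (ht : 0 ≤ t) :
    shifted φ a t ≤ t * shiftedDeriv φ a t := by
  simpa [shifted_zero] using hφ.shifted_sub_le_mul_shiftedDeriv ha le_rfl ht

/-- Monotonicity gives `φ_a(t) ≥ (t/2) φ_a'(t/2)`, and doubling brings `φ_a'(t/2)` back to
`φ_a'(t)`. With `shifted_le`, `φ_a(t)` and `t φ_a'(t)` are equivalent uniformly in `a`. -/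
theorem IsRegularNFunction.mul_shiftedDeriv_le (hφ : IsRegularNFunction φ c₀ c₁) {m : ℕ}
    (hm : 1 ≤ m * c₀) {a t : ℝ} (ha : 0 ≤ a) (ht : 0 ≤ t) :
    t * shiftedDeriv φ a t ≤ 2 ^ (m + 2) * shifted φ a t := by
  have h1 := hφ.isNFunction.mul_shiftedDeriv_le_shifted_sub ha (s := t / 2) (t := t)
    (by positivity) (by linarith)
  have h2 := hφ.shiftedDeriv_mul_le hm ha (l := 2) (t := t / 2) (by norm_num) (by positivity)
  have h3 := hφ.isNFunction.shifted_nonneg ha (t := t / 2) (by positivity)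
  rw [mul_div_cancel₀ _ (two_ne_zero)] at h2
  calc t * shiftedDeriv φ a t ≤ t * (2 ^ (m + 1) * shiftedDeriv φ a (t / 2)) := by gcongr
    _ = 2 ^ (m + 2) * ((t - t / 2) * shiftedDeriv φ a (t / 2)) := by ring
    _ ≤ 2 ^ (m + 2) * shifted φ a t := by gcongr; linarith

theorem IsRegularNFunction.shifted_mul_le (hφ : IsRegularNFunction φ c₀ c₁) {m : ℕ}
    (hm : 1 ≤ m * c₀) {a l t : ℝ} (ha : 0 ≤ a) (hl : 1 ≤ l) (ht : 0 ≤ t) :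
    shifted φ a (l * t) ≤ (2 * l) ^ (m + 2) * shifted φ a t := by
  have h0 : 0 < l := by linarith
  calc shifted φ a (l * t) ≤ l * t * shiftedDeriv φ a (l * t) :=
        hφ.isNFunction.shifted_le ha (by positivity)
    _ ≤ l * t * (l ^ (m + 1) * shiftedDeriv φ a t) := by
        gcongr; exact hφ.shiftedDeriv_mul_le hm ha hl ht
    _ = l ^ (m + 2) * (t * shiftedDeriv φ a t) := by ring
    _ ≤ l ^ (m + 2) * (2 ^ (m + 2) * shifted φ a t) := by
        exact mul_le_mul_of_nonneg_left (hφ.mul_shiftedDeriv_le hm ha ht) (by positivity)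
    _ = (2 * l) ^ (m + 2) * shifted φ a t := by rw [mul_pow]; ring

/-- The sum `s + t` is at most twice the maximum, so the growth bound with `l = 2` suffices. -/
theorem IsRegularNFunction.shifted_add_le (hφ : IsRegularNFunction φ c₀ c₁) {m : ℕ}
    (hm : 1 ≤ m * c₀) {a s t : ℝ} (ha : 0 ≤ a) (hs : 0 ≤ s) (ht : 0 ≤ t) :
    shifted φ a (s + t) ≤ 4 ^ (m + 2) * (shifted φ a s + shifted φ a t) := by
  have hmax : 0 ≤ max s t := le_max_of_le_left hs
  have h1 : s + t ≤ 2 * max s t := by linarith [le_max_left s t, le_max_right s t]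
  have h2 : shifted φ a (max s t) ≤ shifted φ a s + shifted φ a t := by
    have hs' := hφ.isNFunction.shifted_nonneg ha hs
    have ht' := hφ.isNFunction.shifted_nonneg ha ht
    rcases max_choice s t with h | h <;> rw [h] <;> linarith
  calc shifted φ a (s + t) ≤ shifted φ a (2 * max s t) :=
        hφ.isNFunction.shifted_mono ha (by positivity) h1
    _ ≤ (2 * 2) ^ (m + 2) * shifted φ a (max s t) :=
        hφ.shifted_mul_le hm ha one_le_two hmax
    _ ≤ 4 ^ (m + 2) * (shifted φ a s + shifted φ a t) := by
        norm_num; gcongr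

/-- Identifies `φ` with its shift by 0, so that the estimates for shifts also serve for the modular
of `φ`. -/
theorem IsRegularNFunction.shifted_zero_eq (hφ : IsRegularNFunction φ c₀ c₁) {t : ℝ}
    (ht : 0 ≤ t) : shifted φ 0 t = φ t := by
  have h1 : shifted φ 0 t = ∫ s in (0 : ℝ)..t, phiDeriv φ s := by
    rw [shifted_eq]
    apply intervalIntegral.integral_congr
    intro s _
    by_cases h : s = 0
    · simp [h, shiftedDeriv_zero, hφ.isNFunction.deriv_zero]
    · simp [shiftedDeriv, h]
  rw [h1, intervalIntegral.integral_eq_sub_of_hasDerivAt_of_le (f := φ) ht, hφ.isNFunction.map_zero,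
    sub_zero]
  · exact hφ.contDiffOn_one.continuousOn.mono Icc_subset_Ici_self
  · exact fun x hx => hφ.isNFunction.hasDerivAt hx.1
  · apply ContinuousOn.intervalIntegrable
    rw [uIcc_of_le ht]
    exact hφ.continuousOn_phiDeriv.mono Icc_subset_Ici_self

theorem IsRegularNFunction.shifted_le_apply_add (hφ : IsRegularNFunction φ c₀ c₁) {m : ℕ}
    (hm : 1 ≤ m * c₀) {a t : ℝ} (ha : 0 ≤ a) (ht : 0 ≤ t) :
    shifted φ a t ≤ 2 ^ (m + 2) * φ (a + t) := by
  have hat : 0 ≤ a + t := by positivity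
  rcases ht.eq_or_lt with rfl | ht'
  · rw [shifted_zero, ← hφ.shifted_zero_eq hat]
    have := hφ.isNFunction.shifted_nonneg le_rfl hat
    positivity
  have hp := hφ.isNFunction.phiDeriv_nonneg hat
  calc shifted φ a t ≤ t * shiftedDeriv φ a t := hφ.isNFunction.shifted_le ha ht
    _ ≤ (a + t) * shiftedDeriv φ 0 (a + t) := by
        unfold shiftedDeriv
        rw [zero_add, div_self (by positivity)]
        gcongr
        · linarith
        · exact div_le_one_of_le₀ (by linarith) hat
    _ ≤ 2 ^ (m + 2) * φ (a + t) := by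
        rw [← hφ.shifted_zero_eq hat]
        exact hφ.mul_shiftedDeriv_le hm le_rfl hat

theorem IsNFunction.continuousOn_shifted (hφ : IsNFunction φ) {a : ℝ} (ha : 0 ≤ a) :
    ContinuousOn (shifted φ a) (Ici 0) := by
  intro t ht
  have ht' : 0 ≤ t := ht
  have h1 : ContinuousOn (shifted φ a) (uIcc 0 (t + 1)) :=
    intervalIntegral.continuousOn_primitive_interval'
      (hφ.intervalIntegrable_shiftedDeriv ha le_rfl (by positivity)) left_mem_uIcc
  rw [uIcc_of_le (by positivity)] at h1
  refine (h1 t ⟨ht', by linarith⟩).mono_of_mem_nhdsWithin ?_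
  filter_upwards [self_mem_nhdsWithin, mem_nhdsWithin_of_mem_nhds (Iio_mem_nhds (lt_add_one t))]
    with x hx hx' using ⟨hx, le_of_lt hx'⟩

theorem IsNFunction.continuous_shifted_norm (hφ : IsNFunction φ) {a : ℝ} (ha : 0 ≤ a)
    {E : Type*} [SeminormedAddCommGroup E] : Continuous fun x : E => shifted φ a ‖x‖ :=
  (hφ.continuousOn_shifted ha).comp_continuous continuous_norm fun x => norm_nonneg x

end NFunction

/-! ### Consequences of the Hessian bound for the integrand. -/

section Integrand

variable {n N : ℕ} {Ω : Set (Vec n)} {φ : ℝ → ℝ} {f : Mat N n → ℝ} {k K L c₀ c₁ : ℝ}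

theorem IsRegularNFunction.phiDeriv2_nonneg (hφ : IsRegularNFunction φ c₀ c₁) {t : ℝ}
    (ht : 0 < t) : 0 ≤ phiDeriv2 φ t := by
  have h := (hφ.hasDerivAt_phiDeriv ht).hasDerivWithinAt (s := Ici 0)
  rw [← h.derivWithin ((uniqueDiffOn_Ici 0) t ht.le)]
  exact hφ.isNFunction.monotoneOn.derivWithin_nonneg

theorem IsAdmissibleIntegrand.differentiableAt_fderiv (hf : IsAdmissibleIntegrand Ω φ f k K L)
    {Q : Mat N n} (hQ : Q ≠ 0) : DifferentiableAt ℝ (fderiv ℝ f) Q := by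
  have h : ContDiffAt ℝ 2 f Q :=
    (hf.contDiffOn_two Q hQ).contDiffAt (isOpen_compl_singleton.mem_nhds hQ)
  exact (h.fderiv_right (m := 1) (by norm_num)).differentiableAt one_ne_zero

theorem IsAdmissibleIntegrand.continuous_fderiv (hf : IsAdmissibleIntegrand Ω φ f k K L) :
    Continuous (fderiv ℝ f) :=
  hf.contDiff_one.continuous_fderiv one_ne_zero

/-- Along the ray `s ↦ sA` the Hessian bound integrates exactly, since `φ''(s|A|)|A|` is the
derivative of `φ'(s|A|)`. The Hessian is not available at the origin, so the ray is cut at `eA` and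
continuity of `Df` allows `e → 0`. -/
theorem IsAdmissibleIntegrand.norm_fderiv_sub_fderiv_zero_le
    (hf : IsAdmissibleIntegrand Ω φ f k K L) (hφ : IsRegularNFunction φ c₀ c₁) (A : Mat N n) :
    ‖fderiv ℝ f A - fderiv ℝ f 0‖ ≤ |L| * phiDeriv φ ‖A‖ := by
  rcases eq_or_ne A 0 with rfl | hA
  · simp [hφ.isNFunction.deriv_zero]
  have hA' : 0 < ‖A‖ := norm_pos_iff.2 hA
  have key : ∀ e ∈ Ioo (0 : ℝ) 1,
      ‖fderiv ℝ f A - fderiv ℝ f (e • A)‖ ≤ |L| * phiDeriv φ ‖A‖ := by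
    intro e he
    have hg : ∀ s ∈ Icc e 1, HasDerivAt (fun s : ℝ => fderiv ℝ f (s • A) - fderiv ℝ f (e • A))
        (fderiv ℝ (fderiv ℝ f) (s • A) A) s := by
      intro s hs
      have hs0 : s ≠ 0 := (he.1.trans_le hs.1).ne'
      have h1 : HasDerivAt (fun s : ℝ => s • A) A s := by
        simpa using (hasDerivAt_id s).smul_const A
      exact ((hf.differentiableAt_fderiv
        (smul_ne_zero hs0 hA)).hasFDerivAt.comp_hasDerivAt s h1).sub_const _
    have hB : ∀ s ∈ Icc e 1, HasDerivAt (fun s : ℝ => |L| * phiDeriv φ (s * ‖A‖))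
        (|L| * (phiDeriv2 φ (s * ‖A‖) * ‖A‖)) s := by
      intro s hs
      have hs0 : 0 < s := he.1.trans_le hs.1
      have h1 : HasDerivAt (fun s : ℝ => s * ‖A‖) ‖A‖ s := by
        simpa using (hasDerivAt_id s).mul_const ‖A‖
      exact ((hφ.hasDerivAt_phiDeriv (mul_pos hs0 hA')).comp s h1).const_mul _
    have h := image_norm_le_of_norm_deriv_right_le_deriv_boundary' (a := e) (b := 1)
      (fun s hs => (hg s hs).continuousAt.continuousWithinAt)
      (fun s hs => (hg s (Ico_subset_Icc_self hs)).hasDerivWithinAt)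
      (by
        simp only [sub_self, norm_zero]
        exact mul_nonneg (abs_nonneg L)
          (hφ.isNFunction.phiDeriv_nonneg (mul_nonneg he.1.le hA'.le)))
      (fun s hs => (hB s hs).continuousAt.continuousWithinAt)
      (fun s hs => (hB s (Ico_subset_Icc_self hs)).hasDerivWithinAt)
      (by
        intro s hs
        have hs0 : 0 < s := he.1.trans_le hs.1
        have h1 := hf.hessian_bound (s • A) (smul_ne_zero hs0.ne' hA)
        rw [norm_smul, Real.norm_of_nonneg hs0.le] at h1
        have h2 := hφ.phiDeriv2_nonneg (mul_pos hs0 hA')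
        calc ‖fderiv ℝ (fderiv ℝ f) (s • A) A‖ ≤ ‖fderiv ℝ (fderiv ℝ f) (s • A)‖ * ‖A‖ :=
              ContinuousLinearMap.le_opNorm _ _
          _ ≤ (|L| * phiDeriv2 φ (s * ‖A‖)) * ‖A‖ := by
              gcongr
              exact h1.trans (by gcongr; exact le_abs_self L)
          _ = _ := by ring)
      (right_mem_Icc.2 he.2.le)
    simpa using h
  have hlim : Tendsto (fun e : ℝ => ‖fderiv ℝ f A - fderiv ℝ f (e • A)‖) (𝓝[>] 0)
      (𝓝 ‖fderiv ℝ f A - fderiv ℝ f ((0 : ℝ) • A)‖) := by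
    apply tendsto_nhdsWithin_of_tendsto_nhds
    apply Continuous.tendsto
    have := hf.continuous_fderiv
    fun_prop
  rw [zero_smul] at hlim
  refine le_of_tendsto hlim ?_
  filter_upwards [Ioo_mem_nhdsGT (zero_lt_one' ℝ)] with e he using key e he

/-- The derivative of the integrand varies at most like the derivative of the shifted
N-function. -/
theorem IsAdmissibleIntegrand.norm_fderiv_add_sub_le
    (hf : IsAdmissibleIntegrand Ω φ f k K L) (hφ : IsRegularNFunction φ c₀ c₁) (hc₀ : 0 < c₀)
    (A P : Mat N n) :
    ‖fderiv ℝ f (A + P) - fderiv ℝ f A‖ ≤ |L| * (3 / c₀ + 6) * shiftedDeriv φ ‖A‖ ‖P‖ := by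
  rcases eq_or_ne P 0 with rfl | hP
  · simp [shiftedDeriv_zero]
  have hP' : 0 < ‖P‖ := norm_pos_iff.2 hP
  have hAP : 0 < ‖A‖ + ‖P‖ := by positivity
  have hp : 0 ≤ phiDeriv φ (‖A‖ + ‖P‖) := hφ.isNFunction.phiDeriv_nonneg hAP.le
  rw [shiftedDeriv]
  -- For small `P` the ball around `A` of radius `|P|` avoids the origin and the mean value
  -- inequality applies. For large `P` the quotient `|P|/(|A|+|P|)` exceeds 1/3, and comparing both
  -- derivatives with `Df(0)` is enough.
  rcases le_or_gt ‖P‖ (‖A‖ / 2) with h | h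
  · have hA' : 0 < ‖A‖ := by linarith
    have hball : ∀ Z ∈ Metric.closedBall A ‖P‖, ‖A‖ / 2 ≤ ‖Z‖ ∧ ‖Z‖ ≤ ‖A‖ + ‖P‖ := by
      intro Z hZ
      rw [mem_closedBall_iff_norm] at hZ
      constructor
      · linarith [norm_sub_norm_le A Z, norm_sub_rev A Z]
      · linarith [norm_sub_norm_le Z A]
    have hmv := (convex_closedBall A ‖P‖).norm_image_sub_le_of_norm_fderiv_le (𝕜 := ℝ)
      (f := fderiv ℝ f) (C := |L| * (phiDeriv φ (‖A‖ + ‖P‖) / (c₀ * (‖A‖ / 2))))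
      (x := A) (y := A + P)
      (fun Z hZ => hf.differentiableAt_fderiv (norm_pos_iff.1 (by linarith [(hball Z hZ).1])))
      (by
        intro Z hZ
        obtain ⟨h1, h2⟩ := hball Z hZ
        have hZ0 : 0 < ‖Z‖ := by linarith
        refine (hf.hessian_bound Z (norm_pos_iff.1 hZ0)).trans ?_
        have h3 := hφ.phiDeriv2_nonneg hZ0
        refine (mul_le_mul_of_nonneg_right (le_abs_self L) h3).trans ?_
        refine mul_le_mul_of_nonneg_left ?_ (abs_nonneg L)
        rw [le_div_iff₀ (by positivity)]
        calc phiDeriv2 φ ‖Z‖ * (c₀ * (‖A‖ / 2)) ≤ phiDeriv2 φ ‖Z‖ * (c₀ * ‖Z‖) := by gcongr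
          _ = c₀ * (‖Z‖ * phiDeriv2 φ ‖Z‖) := by ring
          _ ≤ phiDeriv φ ‖Z‖ := hφ.lower _ hZ0
          _ ≤ phiDeriv φ (‖A‖ + ‖P‖) := hφ.isNFunction.monotoneOn hZ0.le hAP.le h2)
      (Metric.mem_closedBall_self (norm_nonneg P))
      (by simp)
    rw [add_sub_cancel_left] at hmv
    refine hmv.trans ?_
    have h4 : 1 / (‖A‖ / 2) ≤ 3 / (‖A‖ + ‖P‖) := by
      rw [div_le_div_iff₀ (by positivity) hAP]; linarith
    calc |L| * (phiDeriv φ (‖A‖ + ‖P‖) / (c₀ * (‖A‖ / 2))) * ‖P‖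
        = |L| * (phiDeriv φ (‖A‖ + ‖P‖) * ‖P‖ / c₀) * (1 / (‖A‖ / 2)) := by field_simp
      _ ≤ |L| * (phiDeriv φ (‖A‖ + ‖P‖) * ‖P‖ / c₀) * (3 / (‖A‖ + ‖P‖)) := by gcongr
      _ = |L| * (3 / c₀) * (phiDeriv φ (‖A‖ + ‖P‖) * (‖P‖ / (‖A‖ + ‖P‖))) := by ring
      _ ≤ _ := by gcongr; linarith
  · have h1 : phiDeriv φ ‖A + P‖ ≤ phiDeriv φ (‖A‖ + ‖P‖) :=
      hφ.isNFunction.monotoneOn (norm_nonneg _) hAP.le (norm_add_le A P)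
    have h2 : phiDeriv φ ‖A‖ ≤ phiDeriv φ (‖A‖ + ‖P‖) :=
      hφ.isNFunction.monotoneOn (norm_nonneg _) hAP.le (by linarith)
    have h3 : 1 ≤ 3 * (‖P‖ / (‖A‖ + ‖P‖)) := by
      rw [mul_div_assoc', le_div_iff₀ hAP]; linarith
    calc ‖fderiv ℝ f (A + P) - fderiv ℝ f A‖
        = ‖(fderiv ℝ f (A + P) - fderiv ℝ f 0) - (fderiv ℝ f A - fderiv ℝ f 0)‖ := by
          rw [sub_sub_sub_cancel_right]
      _ ≤ |L| * phiDeriv φ ‖A + P‖ + |L| * phiDeriv φ ‖A‖ :=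
          (norm_sub_le _ _).trans (add_le_add (hf.norm_fderiv_sub_fderiv_zero_le hφ _)
            (hf.norm_fderiv_sub_fderiv_zero_le hφ _))
      _ ≤ |L| * phiDeriv φ (‖A‖ + ‖P‖) + |L| * phiDeriv φ (‖A‖ + ‖P‖) := by gcongr
      _ = |L| * 2 * phiDeriv φ (‖A‖ + ‖P‖) * 1 := by ring
      _ ≤ |L| * 2 * phiDeriv φ (‖A‖ + ‖P‖) * (3 * (‖P‖ / (‖A‖ + ‖P‖))) := by gcongr
      _ = |L| * 6 * (phiDeriv φ (‖A‖ + ‖P‖) * (‖P‖ / (‖A‖ + ‖P‖))) := by ring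
      _ ≤ _ := by
        have : 0 < 3 / c₀ := by positivity
        gcongr; linarith

/-- The mean value inequality for `f - Df(Q)` on the segment from `Q+X` to `Q+X+Y`, all of whose
points lie within `|X|+|Y|` of `Q`. The linearization is taken at `Q` rather than at `Q+X`, so that
its linear term is independent of `X`. -/
theorem IsAdmissibleIntegrand.abs_taylor_le
    (hf : IsAdmissibleIntegrand Ω φ f k K L) (hφ : IsRegularNFunction φ c₀ c₁) (hc₀ : 0 < c₀)
    (Q X Y : Mat N n) :
    |f (Q + X + Y) - f (Q + X) - fderiv ℝ f Q Y| ≤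
      |L| * (3 / c₀ + 6) * shiftedDeriv φ ‖Q‖ (‖X‖ + ‖Y‖) * ‖Y‖ := by
  have h := (convex_segment (Q + X) (Q + X + Y)).norm_image_sub_le_of_norm_fderiv_le' (𝕜 := ℝ)
    (f := f) (φ := fderiv ℝ f Q)
    (C := |L| * (3 / c₀ + 6) * shiftedDeriv φ ‖Q‖ (‖X‖ + ‖Y‖))
    (fun Z _ => hf.contDiff_one.differentiable one_ne_zero Z)
    (by
      intro Z hZ
      rw [segment_eq_image'] at hZ
      obtain ⟨τ, hτ, rfl⟩ := hZ
      beta_reduce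
      rw [add_sub_cancel_left, add_assoc]
      refine (hf.norm_fderiv_add_sub_le hφ hc₀ Q _).trans ?_
      gcongr
      refine hφ.isNFunction.shiftedDeriv_mono (norm_nonneg Q) (norm_nonneg _) ?_
      refine (norm_add_le _ _).trans ?_
      gcongr
      rw [norm_smul, Real.norm_of_nonneg hτ.1]
      exact mul_le_of_le_one_left (norm_nonneg Y) hτ.2)
    (left_mem_segment ℝ _ _) (right_mem_segment ℝ _ _)
  rw [add_sub_cancel_left] at h
  exact h

/-- The second order difference of the integrand that controls the excess energy. -/
theorem IsAdmissibleIntegrand.second_difference_le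
    (hf : IsAdmissibleIntegrand Ω φ f k K L) (hφ : IsRegularNFunction φ c₀ c₁) (hc₀ : 0 < c₀)
    (Q X Y : Mat N n) :
    f (Q + X) - f Q - f (Q + X + Y) + f (Q + Y) ≤
      2 * (|L| * (3 / c₀ + 6)) * shiftedDeriv φ ‖Q‖ (‖X‖ + ‖Y‖) * ‖Y‖ := by
  -- Both increments by `Y`, from `Q+X` and from `Q`, have the same linear term `Df(Q)Y`, which
  -- cancels.
  have h1 := hf.abs_taylor_le hφ hc₀ Q X Y
  have h2 := hf.abs_taylor_le hφ hc₀ Q 0 Y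
  rw [add_zero, norm_zero, zero_add] at h2
  have h3 : |L| * (3 / c₀ + 6) * shiftedDeriv φ ‖Q‖ ‖Y‖ * ‖Y‖ ≤
      |L| * (3 / c₀ + 6) * shiftedDeriv φ ‖Q‖ (‖X‖ + ‖Y‖) * ‖Y‖ := by
    gcongr
    exact hφ.isNFunction.shiftedDeriv_mono (norm_nonneg _) (norm_nonneg _)
      (le_add_of_nonneg_left (norm_nonneg _))
  have h4 := (abs_le.1 h1).1
  have h5 := (abs_le.1 h2).2
  linarith

end Integrand

/-! ### Calculus of weak gradients. -/

section WeakGradient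

variable {n N : ℕ} {Ω : Set (Vec n)}

/-- The tensor product `v ⊗ p`. -/
noncomputable def outer (v : Vec N) (p : Vec n) : Mat N n :=
  WithLp.toLp 2 fun ij => v ij.1 * p ij.2

@[simp]
theorem outer_apply (v : Vec N) (p : Vec n) (i : Fin N) (j : Fin n) :
    outer v p (i, j) = v i * p j := rfl

theorem norm_outer (v : Vec N) (p : Vec n) : ‖outer v p‖ = ‖v‖ * ‖p‖ := by
  rw [EuclideanSpace.norm_eq, EuclideanSpace.norm_eq, EuclideanSpace.norm_eq,
    ← Real.sqrt_mul (Finset.sum_nonneg fun _ _ => by positivity), Fintype.sum_prod_type,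
    Finset.sum_mul_sum]
  simp [mul_pow]

theorem outer_zero (v : Vec N) : outer v (0 : Vec n) = 0 := by
  ext ⟨i, j⟩; simp

theorem continuous_outer : Continuous fun vp : Vec N × Vec n => outer vp.1 vp.2 := by
  unfold outer
  fun_prop

theorem gradient_apply (ζ : Vec n → ℝ) (x : Vec n) (j : Fin n) :
    gradient ζ x j = fderiv ℝ ζ x (EuclideanSpace.single j 1) := by
  rw [← InnerProductSpace.toDual_symm_apply (𝕜 := ℝ) (x := EuclideanSpace.single j 1)
    (y := fderiv ℝ ζ x), EuclideanSpace.inner_single_right]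
  simp [gradient]

theorem norm_gradient (ζ : Vec n → ℝ) (x : Vec n) : ‖gradient ζ x‖ = ‖fderiv ℝ ζ x‖ :=
  LinearIsometryEquiv.norm_map _ _

theorem continuous_gradient {ζ : Vec n → ℝ} (hζ : ContDiff ℝ ∞ ζ) : Continuous (gradient ζ) :=
  (LinearIsometryEquiv.continuous _).comp (hζ.continuous_fderiv (by simp))

theorem continuous_fderiv_single {ζ : Vec n → ℝ} (hζ : ContDiff ℝ ∞ ζ) (j : Fin n) :
    Continuous fun x => fderiv ℝ ζ x (EuclideanSpace.single j 1) :=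
  (hζ.continuous_fderiv (by simp)).clm_apply continuous_const

theorem tsupport_fderiv_single_subset (ζ : Vec n → ℝ) (j : Fin n) :
    tsupport (fun x => fderiv ℝ ζ x (EuclideanSpace.single j 1)) ⊆ tsupport ζ := by
  refine (closure_mono ?_).trans (tsupport_fderiv_subset (𝕜 := ℝ) (f := ζ))
  intro x hx h
  exact hx (by simp [h])

/-- The product vanishes off a compact subset of `Ω`, so local integrability in `Ω` becomes
integrability on the whole space, without any control near the boundary. -/
theorem MeasureTheory.LocallyIntegrableOn.integrable_smul_of_tsupport_subset {E : Type*}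
    [NormedAddCommGroup E] [NormedSpace ℝ E] {g : Vec n → E}
    (hg : LocallyIntegrableOn g Ω volume) {ζ : Vec n → ℝ} (hζ : Continuous ζ)
    (hs : HasCompactSupport ζ) (hsub : tsupport ζ ⊆ Ω) : Integrable fun x => ζ x • g x := by
  have h1 : IntegrableOn g (tsupport ζ) := hg.integrableOn_compact_subset hsub hs
  have h2 : IntegrableOn (fun x => ζ x • g x) (tsupport ζ) :=
    h1.continuousOn_smul hζ.continuousOn hs
  refine (integrableOn_iff_integrable_of_support_subset ?_).1 h2
  exact (Function.support_smul_subset_left ζ g).trans (subset_tsupport ζ)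

theorem MeasureTheory.Integrable.euclidean_apply {ι : Type*} [Fintype ι] {X : Type*}
    [MeasurableSpace X] {μ : Measure X} {g : X → EuclideanSpace ℝ ι} (hg : Integrable g μ)
    (i : ι) : Integrable (fun x => g x i) μ :=
  (EuclideanSpace.proj (𝕜 := ℝ) i : EuclideanSpace ℝ ι →L[ℝ] ℝ).integrable_comp hg

theorem HasWeakGradient.integrable_smul_add_outer {u : Vec n → Vec N} {G : Vec n → Mat N n}
    (h : HasWeakGradient Ω u G) {ζ : Vec n → ℝ} (hζ : ContDiff ℝ ∞ ζ)
    (hs : HasCompactSupport ζ) (hsub : tsupport ζ ⊆ Ω) :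
    Integrable fun x => ζ x • G x + outer (u x) (gradient ζ x) := by
  refine (h.locallyIntegrableOn_grad.integrable_smul_of_tsupport_subset hζ.continuous hs
    hsub).add ?_
  have hts : tsupport (fun x => ‖gradient ζ x‖) ⊆ tsupport ζ := by
    refine (closure_mono ?_).trans (tsupport_fderiv_subset (𝕜 := ℝ) (f := ζ))
    intro x hx h
    exact hx (by simp [norm_gradient, h])
  have h1 := h.locallyIntegrableOn.integrable_smul_of_tsupport_subset
    (continuous_gradient hζ).norm (hs.of_isClosed_subset (isClosed_tsupport _) hts)
    (hts.trans hsub)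
  have h2 : IntegrableOn u (tsupport ζ) :=
    h.locallyIntegrableOn.integrableOn_compact_subset hsub hs
  have hsupp : Function.support (fun x => outer (u x) (gradient ζ x)) ⊆ tsupport ζ := by
    refine subset_trans ?_ ((subset_tsupport _).trans hts)
    intro x hx h0
    rw [norm_eq_zero] at h0
    exact hx (by simp only [h0, outer_zero])
  rw [← integrableOn_iff_integrable_of_support_subset hsupp]
  refine Integrable.mono h1.integrableOn
    (continuous_outer.comp_aestronglyMeasurable₂ h2.aestronglyMeasurable
      (continuous_gradient hζ).aestronglyMeasurable) ?_
  filter_upwards with x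
  rw [norm_outer, norm_smul, norm_norm, mul_comm]

/-- The product rule: multiplication with a cutoff function in `Ω` leads to a function with a
weak gradient on the whole space. -/
theorem HasWeakGradient.smul {u : Vec n → Vec N} {G : Vec n → Mat N n}
    (h : HasWeakGradient Ω u G) {ζ : Vec n → ℝ} (hζ : ContDiff ℝ ∞ ζ)
    (hs : HasCompactSupport ζ) (hsub : tsupport ζ ⊆ Ω) :
    HasWeakGradient univ (fun x => ζ x • u x)
      (fun x => ζ x • G x + outer (u x) (gradient ζ x)) := by
  refine ⟨(h.locallyIntegrableOn.integrable_smul_of_tsupport_subset hζ.continuous hs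
    hsub).locallyIntegrable.locallyIntegrableOn _,
    (h.integrable_smul_add_outer hζ hs hsub).locallyIntegrable.locallyIntegrableOn _, ?_⟩
  intro ψ hψ hψs _ i j
  have hts : tsupport (fun x => ζ x * ψ x) ⊆ tsupport ζ := tsupport_mul_subset_left
  -- The product `ζψ` is a legitimate test function in `Ω` even though `ψ` is arbitrary on the whole
  -- space.
  have key := h.integral_eq (fun x => ζ x * ψ x) (hζ.mul hψ) (hs.mul_right) (hts.trans hsub) i j
  have hz : ∀ x, x ∉ Ω → ζ x = 0 := fun x hx =>
    image_eq_zero_of_notMem_tsupport fun hx' => hx (hsub hx')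
  have hd : ∀ x, fderiv ℝ (fun x => ζ x * ψ x) x (EuclideanSpace.single j 1) =
      ζ x * fderiv ℝ ψ x (EuclideanSpace.single j 1) +
        ψ x * fderiv ℝ ζ x (EuclideanSpace.single j 1) := by
    intro x
    rw [fderiv_fun_mul (hζ.differentiable (by simp) x) (hψ.differentiable (by simp) x)]
    simp
  have hzd : ∀ x, x ∉ Ω → fderiv ℝ ζ x (EuclideanSpace.single j 1) = 0 := fun x hx =>
    image_eq_zero_of_notMem_tsupport (f := fun x => fderiv ℝ ζ x (EuclideanSpace.single j 1))
      fun hx' => hx (hsub (tsupport_fderiv_single_subset ζ j hx'))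
  rw [setIntegral_eq_integral_of_forall_compl_eq_zero
      (fun x hx => by simp only [hd, hz x hx, hzd x hx]; ring),
    setIntegral_eq_integral_of_forall_compl_eq_zero
      (fun x hx => by simp only [hz x hx]; ring)] at key
  have i1 : Integrable fun x => ζ x * u x i * fderiv ℝ ψ x (EuclideanSpace.single j 1) := by
    have := (h.locallyIntegrableOn.integrable_smul_of_tsupport_subset
      (hζ.continuous.mul (continuous_fderiv_single hψ j)) hs.mul_right
      (tsupport_mul_subset_left.trans hsub)).euclidean_apply i
    refine this.congr (ae_of_all _ fun x => ?_)
    simp; ring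
  have i2 : Integrable fun x => ζ x * G x (i, j) * ψ x := by
    have := (h.locallyIntegrableOn_grad.integrable_smul_of_tsupport_subset
      (hζ.continuous.mul hψ.continuous) hs.mul_right
      (tsupport_mul_subset_left.trans hsub)).euclidean_apply (i, j)
    refine this.congr (ae_of_all _ fun x => ?_)
    simp; ring
  have i3 : Integrable fun x => u x i * fderiv ℝ ζ x (EuclideanSpace.single j 1) * ψ x := by
    have hsub' := (tsupport_mul_subset_left (g := ψ)).trans (tsupport_fderiv_single_subset ζ j)
    have := (h.locallyIntegrableOn.integrable_smul_of_tsupport_subset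
      ((continuous_fderiv_single hζ j).mul hψ.continuous)
      (hs.of_isClosed_subset (isClosed_tsupport _) hsub') (hsub'.trans hsub)).euclidean_apply i
    refine this.congr (ae_of_all _ fun x => ?_)
    simp; ring
  have e1 : ∫ x, u x i * fderiv ℝ (fun x => ζ x * ψ x) x (EuclideanSpace.single j 1) =
      (∫ x, ζ x * u x i * fderiv ℝ ψ x (EuclideanSpace.single j 1)) +
        ∫ x, u x i * fderiv ℝ ζ x (EuclideanSpace.single j 1) * ψ x := by
    rw [← integral_add i1 i3]
    congr 1; ext x; rw [hd]; ring
  have e2 : ∫ x, G x (i, j) * (ζ x * ψ x) = ∫ x, ζ x * G x (i, j) * ψ x := by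
    congr 1; ext x; ring
  have e3 : ∫ x, (ζ x • G x + outer (u x) (gradient ζ x)) (i, j) * ψ x =
      (∫ x, ζ x * G x (i, j) * ψ x) +
        ∫ x, u x i * fderiv ℝ ζ x (EuclideanSpace.single j 1) * ψ x := by
    rw [← integral_add i2 i3]
    congr 1; ext x; simp [gradient_apply]; ring
  simp only [setIntegral_univ]
  rw [e3]
  rw [e1, e2] at key
  have e4 : ∫ x, (ζ x • u x) i * fderiv ℝ ψ x (EuclideanSpace.single j 1) =
    ∫ x, ζ x * u x i * fderiv ℝ ψ x (EuclideanSpace.single j 1) := by simp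
  rw [e4]
  linarith

theorem HasWeakGradient.mono {u : Vec n → Vec N} {G : Vec n → Mat N n}
    (h : HasWeakGradient univ u G) (Ω : Set (Vec n)) : HasWeakGradient Ω u G := by
  refine ⟨h.locallyIntegrableOn.mono_set (subset_univ _),
    h.locallyIntegrableOn_grad.mono_set (subset_univ _), ?_⟩
  intro η hη hs hsub i j
  have key := h.integral_eq η hη hs (subset_univ _) i j
  simp only [setIntegral_univ] at key
  rw [setIntegral_eq_integral_of_forall_compl_eq_zero, key,
    setIntegral_eq_integral_of_forall_compl_eq_zero]
  · intro x hx
    rw [image_eq_zero_of_notMem_tsupport fun hx' => hx (hsub hx'), mul_zero]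
  · intro x hx
    rw [image_eq_zero_of_notMem_tsupport
      (f := fun x => fderiv ℝ η x (EuclideanSpace.single j 1))
      fun hx' => hx (hsub (tsupport_fderiv_single_subset η j hx')), mul_zero]

theorem HasWeakGradient.sub {u v : Vec n → Vec N} {G H : Vec n → Mat N n}
    (hu : HasWeakGradient Ω u G) (hv : HasWeakGradient Ω v H) :
    HasWeakGradient Ω (fun x => u x - v x) (fun x => G x - H x) := by
  refine ⟨hu.locallyIntegrableOn.sub hv.locallyIntegrableOn,
    hu.locallyIntegrableOn_grad.sub hv.locallyIntegrableOn_grad, ?_⟩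
  intro η hη hs hsub i j
  have i1 : ∀ {w : Vec n → Vec N}, LocallyIntegrableOn w Ω volume →
      IntegrableOn (fun x => w x i * fderiv ℝ η x (EuclideanSpace.single j 1)) Ω := by
    intro w hw
    have := (hw.integrable_smul_of_tsupport_subset (continuous_fderiv_single hη j)
      (hs.of_isClosed_subset (isClosed_tsupport _) (tsupport_fderiv_single_subset η j))
      ((tsupport_fderiv_single_subset η j).trans hsub)).euclidean_apply i
    refine (this.congr (ae_of_all _ fun x => ?_)).integrableOn
    simp [mul_comm]
  have i2 : ∀ {W : Vec n → Mat N n}, LocallyIntegrableOn W Ω volume →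
      IntegrableOn (fun x => W x (i, j) * η x) Ω := by
    intro W hW
    have := (hW.integrable_smul_of_tsupport_subset hη.continuous hs hsub).euclidean_apply (i, j)
    refine (this.congr (ae_of_all _ fun x => ?_)).integrableOn
    simp [mul_comm]
  simp only [PiLp.sub_apply, sub_mul]
  rw [integral_sub (i1 hu.locallyIntegrableOn) (i1 hv.locallyIntegrableOn),
    integral_sub (i2 hu.locallyIntegrableOn_grad) (i2 hv.locallyIntegrableOn_grad),
    hu.integral_eq η hη hs hsub, hv.integral_eq η hη hs hsub]
  ring

theorem continuous_linPoly (Q : Mat N n) (b : Vec N) : Continuous (linPoly Q b) := by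
  unfold linPoly
  fun_prop

theorem hasWeakGradient_linPoly (Ω : Set (Vec n)) (Q : Mat N n) (b : Vec N) :
    HasWeakGradient Ω (linPoly Q b) fun _ => Q := by
  refine HasWeakGradient.mono ?_ Ω
  refine ⟨(continuous_linPoly Q b).locallyIntegrable.locallyIntegrableOn _,
    (locallyIntegrable_const Q).locallyIntegrableOn _, ?_⟩
  intro η hη hs _ i j
  simp only [setIntegral_univ]
  have hlin : ∀ x : Vec n, HasFDerivAt (fun x : Vec n => linPoly Q b x i)
      (∑ j, Q (i, j) • (EuclideanSpace.proj (𝕜 := ℝ) j : Vec n →L[ℝ] ℝ)) x := by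
    intro x
    have : (fun x : Vec n => linPoly Q b x i) = fun x =>
        (∑ j, Q (i, j) • (EuclideanSpace.proj (𝕜 := ℝ) j : Vec n →L[ℝ] ℝ)) x + b i := by
      ext x; simp [linPoly]
    rw [this]
    exact (ContinuousLinearMap.hasFDerivAt _).add_const _
  have hd : ∀ x, fderiv ℝ (fun x : Vec n => linPoly Q b x i) x (EuclideanSpace.single j 1) =
      Q (i, j) := by
    intro x
    rw [(hlin x).fderiv]
    simp
  have hcont : Continuous fun x : Vec n => linPoly Q b x i := by
    unfold linPoly
    fun_prop
  rw [integral_mul_fderiv_eq_neg_fderiv_mul_of_integrable]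
  · simp only [hd]
  · simp only [hd]
    exact (hη.continuous.integrable_of_hasCompactSupport hs).const_mul _
  · apply Continuous.integrable_of_hasCompactSupport
    · exact hcont.mul (continuous_fderiv_single hη j)
    · exact HasCompactSupport.mul_left (hs.of_isClosed_subset (isClosed_tsupport _)
        (tsupport_fderiv_single_subset η j))
  · exact (hcont.mul hη.continuous).integrable_of_hasCompactSupport hs.mul_left
  · exact fun x _ => (hlin x).differentiableAt
  · exact fun x _ => hη.differentiable (by simp) x

end WeakGradient

/-! ### Mollification and quasiconvexity with Sobolev test functions. -/

section Mollification

variable {n N : ℕ} {Ω : Set (Vec n)} {φ : ℝ → ℝ} {f : Mat N n → ℝ} {k K L c₀ c₁ : ℝ}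

theorem convolution_lsmul_euclidean_apply {ι : Type*} [Fintype ι] {ρ : Vec n → ℝ}
    {g : Vec n → EuclideanSpace ℝ ι} {x : Vec n}
    (h : Integrable fun t => ρ t • g (x - t)) (i : ι) :
    convolution ρ g (ContinuousLinearMap.lsmul ℝ ℝ) volume x i = ∫ t, ρ t * g (x - t) i := by
  rw [convolution_lsmul]
  exact ((EuclideanSpace.proj (𝕜 := ℝ) i : EuclideanSpace ℝ ι →L[ℝ] ℝ).integral_comp_comm h).symm

theorem integrable_smul_translate {E : Type*} [NormedAddCommGroup E] [NormedSpace ℝ E]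
    {ρ : Vec n → ℝ} (hρ : Continuous ρ) (hs : HasCompactSupport ρ) {g : Vec n → E}
    (hg : LocallyIntegrable g) (x : Vec n) : Integrable fun t => ρ t • g (x - t) :=
  HasCompactSupport.convolutionExists_left (ContinuousLinearMap.lsmul ℝ ℝ) hs hρ hg x

/-- The gradient of a mollified function is the mollified weak gradient. -/
theorem HasWeakGradient.grad_convolution {u : Vec n → Vec N} {G : Vec n → Mat N n}
    (h : HasWeakGradient univ u G) {ρ : Vec n → ℝ} (hρ : ContDiff ℝ ∞ ρ)
    (hs : HasCompactSupport ρ) (x : Vec n) :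
    grad (convolution ρ u (ContinuousLinearMap.lsmul ℝ ℝ) volume) x =
      convolution ρ G (ContinuousLinearMap.lsmul ℝ ℝ) volume x := by
  have hu : LocallyIntegrable u := locallyIntegrableOn_univ.1 h.locallyIntegrableOn
  have hG : LocallyIntegrable G := locallyIntegrableOn_univ.1 h.locallyIntegrableOn_grad
  ext ⟨i, j⟩
  rw [convolution_lsmul_euclidean_apply (integrable_smul_translate hρ.continuous hs hG x)]
  have hder := HasCompactSupport.hasFDerivAt_convolution_left (𝕜 := ℝ) (μ := volume)
    (ContinuousLinearMap.lsmul ℝ ℝ) hs (hρ.of_le (by simp)) hu x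
  have hex : Integrable fun t => (ContinuousLinearMap.lsmul ℝ ℝ).precompL (Vec n)
      (fderiv ℝ ρ t) (u (x - t)) :=
    HasCompactSupport.convolutionExists_left _ (hs.fderiv (𝕜 := ℝ))
      (hρ.continuous_fderiv (by simp)) hu x
  have h1 : (grad (convolution ρ u (ContinuousLinearMap.lsmul ℝ ℝ) volume) x) (i, j) =
      ∫ t, fderiv ℝ ρ t (EuclideanSpace.single j 1) * u (x - t) i := by
    simp only [grad]
    rw [hder.fderiv, convolution, ContinuousLinearMap.integral_apply hex]
    refine Eq.trans (((EuclideanSpace.proj (𝕜 := ℝ) i : Vec N →L[ℝ] ℝ).integral_comp_comm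
      (hex.apply_continuousLinearMap _)).symm) ?_
    simp [ContinuousLinearMap.precompL_apply]
  rw [h1]
  -- The reflected kernel is the test function; the sign from its inner derivative cancels the sign
  -- of integration by parts.
  set η : Vec n → ℝ := fun y => ρ (x - y) with hη
  have hηc : ContDiff ℝ ∞ η := hρ.comp (contDiff_const.sub contDiff_id)
  have hηs : HasCompactSupport η := hs.comp_homeomorph (Homeomorph.subLeft x)
  have hηd : ∀ y, fderiv ℝ η y (EuclideanSpace.single j 1) =
      -fderiv ℝ ρ (x - y) (EuclideanSpace.single j 1) := by
    intro y
    have h2 : HasFDerivAt (fun y : Vec n => x - y) (-ContinuousLinearMap.id ℝ (Vec n)) y :=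
      (hasFDerivAt_id y).const_sub x
    have h3 : HasFDerivAt η _ y :=
      ((hρ.differentiable (by simp) (x - y)).hasFDerivAt).comp y h2
    rw [h3.fderiv]
    simp
  have key := h.integral_eq η hηc hηs (subset_univ _) i j
  simp only [setIntegral_univ, hηd, mul_neg, integral_neg, neg_inj] at key
  rw [← integral_sub_left_eq_self _ volume x,
    ← integral_sub_left_eq_self (fun t => ρ t * _) volume x]
  simp only [sub_sub_cancel]
  simp only [hη] at key
  simpa only [mul_comm] using key

/-- Jensen's inequality for the modular of a mollified function. -/
theorem IsNFunction.shifted_norm_convolution_le (hφ : IsNFunction φ) {a : ℝ} (ha : 0 ≤ a)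
    {E : Type*} [NormedAddCommGroup E] [NormedSpace ℝ E]
    {ρ : Vec n → ℝ} (hρ : Continuous ρ) (hs : HasCompactSupport ρ) (hρ0 : ∀ x, 0 ≤ ρ x)
    (hρ1 : ∫ x, ρ x = 1) {G : Vec n → E} (hG : LocallyIntegrable G)
    (hg : LocallyIntegrable fun x => shifted φ a ‖G x‖) (x : Vec n) :
    shifted φ a ‖convolution ρ G (ContinuousLinearMap.lsmul ℝ ℝ) volume x‖ ≤
      convolution ρ (fun x => shifted φ a ‖G x‖) (ContinuousLinearMap.lsmul ℝ ℝ) volume x := by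
  rw [convolution_lsmul, convolution_lsmul]
  simp only [smul_eq_mul]
  have i1 : Integrable fun t => ρ t * ‖G (x - t)‖ :=
    by
    refine (integrable_smul_translate hρ hs hG x).norm.congr (ae_of_all _ fun t => ?_)
    simp only [norm_smul, Real.norm_of_nonneg (hρ0 t)]
  have i2 : Integrable fun t => ρ t * shifted φ a ‖G (x - t)‖ :=
    integrable_smul_translate hρ hs hg x
  have i0 : Integrable ρ := hρ.integrable_of_hasCompactSupport hs
  set t₀ := ∫ t, ρ t * ‖G (x - t)‖ with ht₀
  have h0 : 0 ≤ t₀ := integral_nonneg fun t => mul_nonneg (hρ0 t) (norm_nonneg _)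
  have h1 : ‖∫ t, ρ t • G (x - t)‖ ≤ t₀ := by
    refine (norm_integral_le_integral_norm _).trans_eq ?_
    congr 1; ext t
    rw [norm_smul, Real.norm_of_nonneg (hρ0 t)]
  refine (hφ.shifted_mono ha (norm_nonneg _) h1).trans ?_
  -- The tangent line of `φ_a` at the average `t₀`, integrated against the probability density `ρ`.
  have h2 : ∫ t, (ρ t * (shifted φ a t₀ - shiftedDeriv φ a t₀ * t₀) +
      shiftedDeriv φ a t₀ * (ρ t * ‖G (x - t)‖)) ≤ ∫ t, ρ t * shifted φ a ‖G (x - t)‖ := by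
    refine integral_mono ((i0.mul_const _).add (i1.const_mul _)) i2 fun t => ?_
    have h3 := mul_le_mul_of_nonneg_left
      (hφ.shifted_tangent_le ha h0 (norm_nonneg (G (x - t)))) (hρ0 t)
    refine le_trans (le_of_eq ?_) h3
    ring
  rw [integral_add (i0.mul_const _) (i1.const_mul _), integral_mul_const, integral_const_mul, hρ1,
    ← ht₀] at h2
  linarith

/-- Fatou's lemma, phrased for Bochner integrals with a uniform bound. -/
theorem integral_le_of_tendsto_ae_of_nonneg {α : Type*} [MeasurableSpace α] {μ : Measure α}
    {H : ℕ → α → ℝ} {H' : α → ℝ} {M : ℝ} (hH : ∀ j, Integrable (H j) μ)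
    (hH0 : ∀ j x, 0 ≤ H j x) (hH' : Integrable H' μ)
    (hlim : ∀ᵐ x ∂μ, Tendsto (fun j => H j x) atTop (𝓝 (H' x)))
    (hM : ∀ j, ∫ x, H j x ∂μ ≤ M) : ∫ x, H' x ∂μ ≤ M := by
  have hM0 : 0 ≤ M := (integral_nonneg (hH0 0)).trans (hM 0)
  have hH'0 : 0 ≤ᵐ[μ] H' := by
    filter_upwards [hlim] with x hx using ge_of_tendsto' hx fun j => hH0 j x
  rw [integral_eq_lintegral_of_nonneg_ae hH'0 hH'.aestronglyMeasurable]
  refine ENNReal.toReal_le_of_le_ofReal hM0 ?_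
  calc ∫⁻ x, ENNReal.ofReal (H' x) ∂μ
      = ∫⁻ x, liminf (fun j => ENNReal.ofReal (H j x)) atTop ∂μ := by
        refine lintegral_congr_ae ?_
        filter_upwards [hlim] with x hx using (ENNReal.tendsto_ofReal hx).liminf_eq.symm
    _ ≤ liminf (fun j => ∫⁻ x, ENNReal.ofReal (H j x) ∂μ) atTop :=
        lintegral_liminf_le' fun j => (hH j).aestronglyMeasurable.aemeasurable.ennreal_ofReal
    _ ≤ liminf (fun _ : ℕ => ENNReal.ofReal M) atTop := by
        refine liminf_le_liminf (Eventually.of_forall fun j => ?_)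
        rw [← ofReal_integral_eq_lintegral_ofReal (hH j) (ae_of_all _ (hH0 j))]
        exact ENNReal.ofReal_le_ofReal (hM j)
    _ = ENNReal.ofReal M := by simp

/-- A qualitative comparison of `φ_a` with `φ`: the constant depends on `a` and serves integrability
and limits only, never the constant of the theorem. -/
theorem IsRegularNFunction.exists_shifted_le (hφ : IsRegularNFunction φ c₀ c₁) (hc₀ : 0 < c₀)
    {a : ℝ} (ha : 0 ≤ a) :
    ∃ C : ℝ, 0 ≤ C ∧ ∀ t, 0 ≤ t → shifted φ a t ≤ C * (1 + shifted φ 0 t) ∧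
      shifted φ 0 (a + t) ≤ C * (1 + shifted φ 0 t) := by
  obtain ⟨m, hm⟩ := exists_nat_ge (1 / c₀)
  rw [div_le_iff₀ hc₀] at hm
  have h0 := hφ.isNFunction.shifted_nonneg le_rfl ha
  have key : ∀ t, 0 ≤ t → shifted φ 0 (a + t) ≤
      4 ^ (m + 2) * (1 + shifted φ 0 a) * (1 + shifted φ 0 t) := by
    intro t ht
    have h1 := hφ.isNFunction.shifted_nonneg le_rfl ht
    refine (hφ.shifted_add_le hm le_rfl ha ht).trans ?_
    rw [mul_assoc]
    refine mul_le_mul_of_nonneg_left ?_ (by positivity)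
    nlinarith
  refine ⟨2 ^ (m + 2) * (4 ^ (m + 2) * (1 + shifted φ 0 a)), by positivity, fun t ht => ⟨?_, ?_⟩⟩
  · refine (hφ.shifted_le_apply_add hm ha ht).trans ?_
    rw [← hφ.shifted_zero_eq (by positivity), mul_assoc]
    exact mul_le_mul_of_nonneg_left (key t ht) (by positivity)
  · refine (key t ht).trans ?_
    have h1 := hφ.isNFunction.shifted_nonneg le_rfl ht
    rw [mul_assoc (2 ^ (m + 2))]
    exact le_mul_of_one_le_left (by positivity) (one_le_pow₀ one_le_two)

theorem IsAdmissibleIntegrand.exists_growth (hf : IsAdmissibleIntegrand Ω φ f k K L)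
    (hφ : IsRegularNFunction φ c₀ c₁) (hc₀ : 0 < c₀) (Q : Mat N n) :
    ∃ C : ℝ, 0 ≤ C ∧ ∀ P : Mat N n, |f (Q + P)| ≤ C * (1 + shifted φ 0 ‖P‖) := by
  obtain ⟨C, hC, h⟩ := hφ.exists_shifted_le hc₀ (norm_nonneg Q)
  refine ⟨|K| * C, by positivity, fun P => ?_⟩
  have h1 := hφ.isNFunction.shifted_nonneg le_rfl (norm_nonneg (Q + P))
  calc |f (Q + P)| ≤ K * φ ‖Q + P‖ := hf.growth _
    _ = K * shifted φ 0 ‖Q + P‖ := by rw [hφ.shifted_zero_eq (norm_nonneg _)]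
    _ ≤ |K| * shifted φ 0 ‖Q + P‖ := by gcongr; exact le_abs_self K
    _ ≤ |K| * shifted φ 0 (‖Q‖ + ‖P‖) := by
        refine mul_le_mul_of_nonneg_left ?_ (abs_nonneg K)
        exact hφ.isNFunction.shifted_mono le_rfl (norm_nonneg _) (norm_add_le Q P)
    _ ≤ |K| * (C * (1 + shifted φ 0 ‖P‖)) := by
        gcongr; exact (h _ (norm_nonneg P)).2
    _ = _ := by ring

/-- Strict quasiconvexity with Sobolev test functions. -/
theorem IsAdmissibleIntegrand.quasiconvex_weak (hf : IsAdmissibleIntegrand Ω φ f k K L)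
    (hφ : IsRegularNFunction φ c₀ c₁) (hc₀ : 0 < c₀) {x₀ : Vec n} {s r : ℝ} (hr : 0 < r)
    (hsr : s < r) (hΩ : Metric.ball x₀ r ⊆ Ω) (Q : Mat N n) {ξ : Vec n → Vec N}
    {X : Vec n → Mat N n} (hξ : HasWeakGradient univ ξ X)
    (hξ0 : ∀ x, x ∉ Metric.closedBall x₀ s → ξ x = 0)
    (hX0 : ∀ x, x ∉ Metric.closedBall x₀ s → X x = 0)
    (hX : Integrable fun x => shifted φ 0 ‖X x‖) :
    k * ∫ y in Metric.ball x₀ r, shifted φ ‖Q‖ ‖X y‖ ≤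
      ∫ y in Metric.ball x₀ r, (f (Q + X y) - f Q) := by
  have hN := hφ.isNFunction
  have hξl : LocallyIntegrable ξ := locallyIntegrableOn_univ.1 hξ.locallyIntegrableOn
  have hXl : LocallyIntegrable X := locallyIntegrableOn_univ.1 hξ.locallyIntegrableOn_grad
  set B := Metric.ball x₀ r with hB
  have hBfin : IsFiniteMeasure (volume.restrict B) :=
    ⟨by rw [Measure.restrict_apply_univ]; exact measure_ball_lt_top⟩
  obtain ⟨C₁, hC₁, hb₁⟩ := hf.exists_growth hφ hc₀ Q
  obtain ⟨C₂, hC₂, hb₂⟩ := hφ.exists_shifted_le hc₀ (norm_nonneg Q)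
  -- The claim becomes `∫ D(X) ≥ 0`. As `D` has no sign, Fatou's lemma is applied to `C(1+φ) - D`,
  -- which is nonnegative by growth.
  set D : Mat N n → ℝ := fun P => (f (Q + P) - f Q) - k * shifted φ ‖Q‖ ‖P‖ with hD
  have hfc : Continuous f := hf.contDiff_one.continuous
  have hsc := hN.continuous_shifted_norm (norm_nonneg Q) (E := Mat N n)
  have hfQc : Continuous fun P => f (Q + P) := by fun_prop
  have hDc : Continuous D := by fun_prop
  set C := C₁ + |f Q| + |k| * C₂ with hC
  have hC0 : 0 ≤ C := by positivity
  have hDb : ∀ P, |D P| ≤ C * (1 + shifted φ 0 ‖P‖) := by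
    intro P
    have h0 := hN.shifted_nonneg le_rfl (norm_nonneg P)
    have h1 := hb₁ P
    have h2 := (hb₂ _ (norm_nonneg P)).1
    have h3 := hN.shifted_nonneg (norm_nonneg Q) (norm_nonneg P)
    have h4 : |k * shifted φ ‖Q‖ ‖P‖| ≤ |k| * (C₂ * (1 + shifted φ 0 ‖P‖)) := by
      rw [abs_mul, abs_of_nonneg h3]; gcongr
    have h5 : |f Q| ≤ |f Q| * (1 + shifted φ 0 ‖P‖) :=
      le_mul_of_one_le_right (abs_nonneg _) (by linarith)
    calc |D P| ≤ |f (Q + P)| + |f Q| + |k * shifted φ ‖Q‖ ‖P‖| :=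
          (abs_sub _ _).trans (add_le_add_left (abs_sub _ _) _)
      _ ≤ _ := by rw [hC]; linarith
  -- The outer radius stays below `(r-s)/2`, so the mollified functions keep their support inside
  -- the ball of radius `r`; the fixed ratio 2 of the radii is what the almost everywhere
  -- convergence requires.
  let bump : ℕ → ContDiffBump (0 : Vec n) := fun j =>
    { rIn := (r - s) / (4 * (j + 1))
      rOut := (r - s) / (2 * (j + 1))
      rIn_pos := div_pos (by linarith) (by positivity)
      rIn_lt_rOut := by
        apply div_lt_div_of_pos_left (by linarith) (by positivity)
        have : (0 : ℝ) ≤ j := j.cast_nonneg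
        linarith }
  have hout : ∀ j, (bump j).rOut ≤ (r - s) / 2 := by
    intro j
    apply div_le_div_of_nonneg_left (by linarith) (by positivity)
    have : (0 : ℝ) ≤ j := j.cast_nonneg
    linarith
  have htend : Tendsto (fun j => (bump j).rOut) atTop (𝓝 0) := by
    have h1 := (tendsto_one_div_add_atTop_nhds_zero_nat (𝕜 := ℝ)).const_mul ((r - s) / 2)
    rw [mul_zero] at h1
    refine h1.congr fun j => ?_
    change _ = (r - s) / (2 * (j + 1))
    field_simp
  have hratio : ∀ᶠ j in atTop, (bump j).rOut ≤ 2 * (bump j).rIn := by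
    refine Eventually.of_forall fun j => le_of_eq ?_
    change (r - s) / (2 * (j + 1)) = 2 * ((r - s) / (4 * (j + 1)))
    field_simp
    norm_num
  set ρ : ℕ → Vec n → ℝ := fun j => (bump j).normed volume with hρ
  have hρc : ∀ j, ContDiff ℝ ∞ (ρ j) := fun j => (bump j).contDiff_normed
  have hρs : ∀ j, HasCompactSupport (ρ j) := fun j => (bump j).hasCompactSupport_normed
  have hρ0 : ∀ j x, 0 ≤ ρ j x := fun j x => (bump j).nonneg_normed x
  have hρ1 : ∀ j, ∫ x, ρ j x = 1 := fun j => (bump j).integral_normed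
  have hρi : ∀ j, Integrable (ρ j) := fun j =>
    (hρc j).continuous.integrable_of_hasCompactSupport (hρs j)
  set w : ℕ → Vec n → Vec N := fun j =>
    convolution (ρ j) ξ (ContinuousLinearMap.lsmul ℝ ℝ) volume with hw
  set g : Vec n → ℝ := fun x => shifted φ 0 ‖X x‖ with hg
  set gj : ℕ → Vec n → ℝ := fun j =>
    convolution (ρ j) g (ContinuousLinearMap.lsmul ℝ ℝ) volume with hgj
  have hgrad : ∀ j x, grad (w j) x =
      convolution (ρ j) X (ContinuousLinearMap.lsmul ℝ ℝ) volume x := fun j x =>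
    hξ.grad_convolution (hρc j) (hρs j) x
  have hwc : ∀ j, ContDiff ℝ 1 (w j) := fun j =>
    HasCompactSupport.contDiff_convolution_left (n := 1) _ (hρs j) ((hρc j).of_le (by simp)) hξl
  have hgc : ∀ j, Continuous (grad (w j)) := by
    intro j
    have : grad (w j) = convolution (ρ j) X (ContinuousLinearMap.lsmul ℝ ℝ) volume :=
      funext (hgrad j)
    rw [this]
    exact HasCompactSupport.continuous_convolution_left _ (hρs j) (hρc j).continuous hXl
  have hts : ∀ j, tsupport (w j) ⊆ Metric.closedBall x₀ (s + (r - s) / 2) := by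
    intro j
    refine closure_minimal ?_ Metric.isClosed_closedBall
    refine (support_convolution_subset _).trans ?_
    rintro _ ⟨y, hy, z, hz, rfl⟩
    rw [(bump j).support_normed_eq, mem_ball_zero_iff] at hy
    have hz' : z ∈ Metric.closedBall x₀ s := by
      by_contra h; exact hz (hξ0 z h)
    rw [mem_closedBall_iff_norm] at hz' ⊢
    calc ‖y + z - x₀‖ = ‖y + (z - x₀)‖ := by rw [add_sub_assoc]
      _ ≤ ‖y‖ + ‖z - x₀‖ := norm_add_le _ _
      _ ≤ _ := by linarith [hout j]
  have hsub : Metric.closedBall x₀ (s + (r - s) / 2) ⊆ B :=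
    Metric.closedBall_subset_ball (by linarith)
  have hcs : ∀ j, HasCompactSupport (w j) := fun j =>
    (isCompact_closedBall x₀ _).of_isClosed_subset (isClosed_tsupport _) (hts j)
  have hcont_int : ∀ {F : Vec n → ℝ}, Continuous F → IntegrableOn F B := fun hF =>
    (hF.continuousOn.integrableOn_compact (isCompact_closedBall x₀ r)).mono_set
      Metric.ball_subset_closedBall
  have hqc : ∀ j, 0 ≤ ∫ y in B, D (grad (w j) y) := by
    intro j
    have h1 := hf.quasiconvex x₀ r hr hΩ Q (w j) (hwc j) (hcs j) ((hts j).trans hsub)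
    have i1 : IntegrableOn (fun y => f (Q + grad (w j) y) - f Q) B :=
      hcont_int ((hfQc.comp (hgc j)).sub continuous_const)
    have i2 : IntegrableOn (fun y => shifted φ ‖Q‖ ‖grad (w j) y‖) B :=
      hcont_int (hsc.comp (hgc j))
    have h2 : ∫ y in B, D (grad (w j) y) = (∫ y in B, (f (Q + grad (w j) y) - f Q)) -
        k * ∫ y in B, shifted φ ‖Q‖ ‖grad (w j) y‖ := by
      rw [← integral_const_mul, ← integral_sub i1 (i2.const_mul k)]
    linarith
  have hgji : ∀ j, Integrable (gj j) := fun j =>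
    (hρi j).integrable_convolution _ hX
  have hgjint : ∀ j, ∫ x, gj j x = ∫ x, g x := by
    intro j
    rw [hgj]
    simp only
    rw [integral_convolution _ (hρi j) hX, hρ1]
    simp
  have hgB : ∫ x in B, g x = ∫ x, g x := by
    refine setIntegral_eq_integral_of_forall_compl_eq_zero fun x hx => ?_
    have : X x = 0 := hX0 x fun h => hx (Metric.closedBall_subset_ball hsr h)
    simp [hg, this, shifted_zero]
  have hjensen : ∀ j x, shifted φ 0 ‖grad (w j) x‖ ≤ gj j x := by
    intro j x
    rw [hgrad]
    exact hN.shifted_norm_convolution_le le_rfl (hρc j).continuous (hρs j) (hρ0 j) (hρ1 j) hXl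
      hX.locallyIntegrable x
  have hDXi : IntegrableOn (fun x => D (X x)) B := by
    refine Integrable.mono' (((integrable_const (1 : ℝ)).add hX.integrableOn).const_mul C)
      (hDc.comp_aestronglyMeasurable hXl.aestronglyMeasurable.restrict) (ae_of_all _ fun x => ?_)
    exact hDb _
  have hsplit : ∀ {F H : Vec n → ℝ}, IntegrableOn F B → IntegrableOn H B →
      ∫ x in B, (C * (1 + F x) - H x) =
        C * (volume.real B + ∫ x in B, F x) - ∫ x in B, H x := by
    intro F H hF hH
    have i1 : IntegrableOn (fun x => C * (1 + F x)) B :=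
      ((integrable_const (1 : ℝ)).add hF).const_mul C
    rw [integral_sub i1 hH, integral_const_mul, integral_add (integrable_const (1 : ℝ)) hF]
    simp
  -- By Jensen `φ(|∇w_j|) ≤ g_j`, so the approximating integrands are nonnegative. Their integrals
  -- are bounded because `∫ g_j = ∫ g` and `∫ D(∇w_j) ≥ 0`; the finite term `C(|B| + ∫ g)` then
  -- drops out.
  have key : ∫ x in B, (C * (1 + g x) - D (X x)) ≤
      C * (volume.real B + ∫ x, g x) := by
    refine integral_le_of_tendsto_ae_of_nonneg
      (H := fun j x => C * (1 + gj j x) - D (grad (w j) x)) ?_ ?_ ?_ ?_ ?_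
    · exact fun j => (((integrable_const (1 : ℝ)).add (hgji j).integrableOn).const_mul C).sub
        (hcont_int (hDc.comp (hgc j)))
    · intro j x
      have h1 := (le_abs_self _).trans (hDb (grad (w j) x))
      have h2 : C * (1 + shifted φ 0 ‖grad (w j) x‖) ≤ C * (1 + gj j x) := by
        gcongr; exact hjensen j x
      linarith
    · exact (((integrable_const (1 : ℝ)).add hX.integrableOn).const_mul C).sub hDXi
    · have h1 := ContDiffBump.ae_convolution_tendsto_right_of_locallyIntegrable htend hratio hXl
      have h2 := ContDiffBump.ae_convolution_tendsto_right_of_locallyIntegrable htend hratio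
        hX.locallyIntegrable
      refine ae_restrict_of_ae ?_
      filter_upwards [h1, h2] with x hx1 hx2
      refine ((hx2.const_add 1).const_mul C).sub ?_
      refine (hDc.tendsto (X x)).comp ?_
      refine hx1.congr fun j => ?_
      rw [hgrad]
    · intro j
      have hDi : IntegrableOn (fun x => D (grad (w j) x)) B := hcont_int (hDc.comp (hgc j))
      rw [hsplit (hgji j).integrableOn hDi]
      have h1 : ∫ x in B, gj j x ≤ ∫ x, g x := by
        rw [← hgjint j]
        refine setIntegral_le_integral (hgji j) (ae_of_all _ fun x => ?_)
        exact (hN.shifted_nonneg le_rfl (norm_nonneg _)).trans (hjensen j x)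
      have h2 := mul_le_mul_of_nonneg_left h1 hC0
      linarith [hqc j]
  rw [hsplit hX.integrableOn hDXi, hgB] at key
  have i1 : IntegrableOn (fun y => f (Q + X y) - f Q) B := by
    refine Integrable.mono' ((((integrable_const (1 : ℝ)).add hX.integrableOn).const_mul C₁).add
      (integrable_const |f Q|))
      ((hfQc.sub continuous_const).comp_aestronglyMeasurable hXl.aestronglyMeasurable.restrict)
      (ae_of_all _ fun x => ?_)
    exact (abs_sub _ _).trans (add_le_add_left (hb₁ _) _)
  have i2 : IntegrableOn (fun y => shifted φ ‖Q‖ ‖X y‖) B := by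
    refine Integrable.mono' (((integrable_const (1 : ℝ)).add hX.integrableOn).const_mul C₂)
      (hsc.comp_aestronglyMeasurable hXl.aestronglyMeasurable.restrict)
      (ae_of_all _ fun x => ?_)
    rw [Real.norm_of_nonneg (hN.shifted_nonneg (norm_nonneg Q) (norm_nonneg _))]
    exact (hb₂ _ (norm_nonneg _)).1
  have hfin : ∫ x in B, D (X x) = (∫ y in B, (f (Q + X y) - f Q)) -
      k * ∫ y in B, shifted φ ‖Q‖ ‖X y‖ := by
    rw [← integral_const_mul, ← integral_sub i1 (i2.const_mul k)]
  linarith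

end Mollification

/-! ### Smooth cutoff functions between concentric balls. -/

section Cutoff

theorem deriv_smoothTransition_of_neg {t : ℝ} (ht : t < 0) :
    deriv Real.smoothTransition t = 0 := by
  have : Real.smoothTransition =ᶠ[𝓝 t] fun _ => 0 := by
    filter_upwards [Iio_mem_nhds ht] with x hx
      using Real.smoothTransition.zero_of_nonpos (le_of_lt hx)
  rw [this.deriv_eq, deriv_const]

/-- Compactness of `[0,1]` gives the bound; the transition is constant on either side. Requiring `1
≤ M` lets the same constant dominate the factors `η` and `1 - η` later. -/
theorem exists_norm_deriv_smoothTransition_le :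
    ∃ M : ℝ, 1 ≤ M ∧ ∀ t, |deriv Real.smoothTransition t| ≤ M := by
  have hc : Continuous (deriv Real.smoothTransition) :=
    (Real.smoothTransition.contDiff (n := 1)).continuous_deriv le_rfl
  obtain ⟨M, hM⟩ := (isCompact_Icc (a := (0 : ℝ)) (b := 1)).exists_bound_of_continuousOn
    hc.continuousOn
  refine ⟨max M 1, le_max_right _ _, fun t => ?_⟩
  by_cases ht : t ∈ Icc (0 : ℝ) 1
  · exact (hM t ht).trans (le_max_left _ _)
  · have h0 : deriv Real.smoothTransition t = 0 := by
      rcases lt_or_ge t 0 with h | h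
      · exact deriv_smoothTransition_of_neg h
      · have h1 : 1 < t := by by_contra h'; exact ht ⟨h, not_lt.1 h'⟩
        have : Real.smoothTransition =ᶠ[𝓝 t] fun _ => 1 := by
          filter_upwards [Ioi_mem_nhds h1] with x hx
            using Real.smoothTransition.one_of_one_le (le_of_lt hx)
        rw [this.deriv_eq, deriv_const]
    rw [h0, abs_zero]
    exact zero_le_one.trans (le_max_right _ _)

/-- Cutoff functions between concentric balls, with the natural bound for the gradient. -/
theorem exists_cutoff : ∃ M : ℝ, 1 ≤ M ∧ ∀ {n : ℕ} (x₀ : Vec n) {s r : ℝ}, 0 < s → s < r →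
    ∃ η : Vec n → ℝ, ContDiff ℝ ∞ η ∧ (∀ x, 0 ≤ η x ∧ η x ≤ 1) ∧
      (∀ x ∈ Metric.ball x₀ s, η x = 1) ∧ tsupport η ⊆ Metric.closedBall x₀ r ∧
      ∀ x, ‖fderiv ℝ η x‖ ≤ M / (r - s) := by
  obtain ⟨M, hM1, hM⟩ := exists_norm_deriv_smoothTransition_le
  refine ⟨2 * M, by linarith, fun {n} x₀ {s r} hs hsr => ?_⟩
  have hr : 0 < r := hs.trans hsr
  have hd : 0 < r ^ 2 - s ^ 2 := by nlinarith
  -- The squared norm keeps this profile smooth at the center; it is at least 1 on the inner ball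
  -- and at most 0 outside the outer one.
  set θ : Vec n → ℝ := fun x => (r ^ 2 - ‖x - x₀‖ ^ 2) / (r ^ 2 - s ^ 2) with hθ
  have hθc : ContDiff ℝ ∞ θ :=
    (contDiff_const.sub (ContDiff.norm_sq ℝ (contDiff_id.sub contDiff_const))).div_const _
  refine ⟨fun x => Real.smoothTransition (θ x), Real.smoothTransition.contDiff.comp hθc,
    fun x => ⟨Real.smoothTransition.nonneg _, Real.smoothTransition.le_one _⟩, ?_, ?_, ?_⟩
  · intro x hx
    rw [mem_ball_iff_norm] at hx
    apply Real.smoothTransition.one_of_one_le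
    rw [hθ, one_le_div hd]
    nlinarith [norm_nonneg (x - x₀)]
  · refine closure_minimal ?_ Metric.isClosed_closedBall
    intro x hx
    rw [mem_closedBall_iff_norm]
    by_contra h
    push Not at h
    refine hx (Real.smoothTransition.zero_of_nonpos ?_)
    refine div_nonpos_of_nonpos_of_nonneg ?_ hd.le
    nlinarith
  · intro x
    have h1 : HasFDerivAt θ 
        ((r ^ 2 - s ^ 2)⁻¹ • (-((2 : ℕ) • innerSL ℝ (x - x₀) : Vec n →L[ℝ] ℝ))) x := by
      have h2 : HasFDerivAt (fun x : Vec n => ‖x - x₀‖ ^ 2)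
          ((2 : ℕ) • innerSL ℝ (x - x₀) : Vec n →L[ℝ] ℝ) x := by
        simpa using ((hasFDerivAt_id x).sub_const x₀).norm_sq
      have h3 := (h2.const_sub (r ^ 2)).const_mul (r ^ 2 - s ^ 2)⁻¹
      simpa only [hθ, div_eq_inv_mul] using h3
    have h4 : HasDerivAt Real.smoothTransition (deriv Real.smoothTransition (θ x)) (θ x) :=
      ((Real.smoothTransition.contDiff (n := 1)).differentiable one_ne_zero _).hasDerivAt
    have h5 := h4.comp_hasFDerivAt x h1
    have h6 : fderiv ℝ (fun x => Real.smoothTransition (θ x)) x = _ := h5.fderiv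
    rw [h6]
    -- Outside the outer ball the derivative vanishes; inside, the gradient of `θ` is at most
    -- `2r/(r²-s²) ≤ 2/(r-s)`.
    rcases lt_or_ge r ‖x - x₀‖ with hx | hx
    · have : θ x < 0 := div_neg_of_neg_of_pos (by nlinarith) hd
      rw [deriv_smoothTransition_of_neg this, zero_smul, norm_zero]
      exact div_nonneg (by linarith) (by linarith)
    · rw [norm_smul, norm_smul, norm_neg, Real.norm_eq_abs, Real.norm_eq_abs,
        abs_of_pos (inv_pos.2 hd)]
      have h7 : ‖((2 : ℕ) • innerSL ℝ (x - x₀) : Vec n →L[ℝ] ℝ)‖ ≤ 2 * r := by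
        refine (norm_nsmul_le).trans ?_
        rw [innerSL_apply_norm]
        push_cast
        linarith
      calc |deriv Real.smoothTransition (θ x)| * ((r ^ 2 - s ^ 2)⁻¹ *
            ‖((2 : ℕ) • innerSL ℝ (x - x₀) : Vec n →L[ℝ] ℝ)‖)
          ≤ M * ((r ^ 2 - s ^ 2)⁻¹ * (2 * r)) := by gcongr; exact hM _
        _ = 2 * M * (r / (r ^ 2 - s ^ 2)) := by ring
        _ ≤ 2 * M * (1 / (r - s)) := by
            refine mul_le_mul_of_nonneg_left ?_ (by linarith)
            rw [div_le_div_iff₀ hd (by linarith)]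
            nlinarith
        _ = 2 * M / (r - s) := by ring

end Cutoff

/-! ### The absorption lemma. -/

section Iteration

/-- The iteration lemma that absorbs the hole-filling term. -/
theorem exists_iteration_bound {θ : ℝ} (hθ0 : 0 ≤ θ) (hθ1 : θ < 1) (p : ℕ) :
    ∃ c : ℝ, 0 < c ∧ ∀ (Z : ℝ → ℝ) (R A D : ℝ), 0 < R →
      (∀ s, R ≤ s → s ≤ 2 * R → Z s ≤ D) →
      (∀ s t, R ≤ s → s < t → t ≤ 2 * R → Z s ≤ θ * Z t + A * (R / (t - s)) ^ p) →
      Z R ≤ c * A := by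
  -- The radii will be `R(2 - l^i)` with `l = 1 - ε`, whose gaps shrink like `l^i`. The errors sum
  -- to a geometric series with ratio `κ = θ/l^p`, which needs `θ < l^p`; with this `ε` Bernoulli's
  -- inequality gives `l^p ≥ (1+θ)/2`.
  set ε := (1 - θ) / (2 * (p + 1)) with hε
  have hp : (0 : ℝ) ≤ p := p.cast_nonneg
  have hε0 : 0 < ε := div_pos (by linarith) (by linarith)
  have hε1 : ε < 1 := by rw [hε, div_lt_one (by linarith)]; linarith
  set l := 1 - ε with hl
  have hl0 : 0 < l := by linarith
  have hl1 : l < 1 := by linarith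
  have hlp : θ < l ^ p := by
    have h1 := one_add_mul_le_pow (a := -ε) (by linarith) p
    have h2 : p * ε ≤ (1 - θ) / 2 := by
      rw [hε, mul_div_assoc', div_le_div_iff₀ (by linarith) (by norm_num)]
      nlinarith
    rw [← sub_eq_add_neg, ← hl] at h1
    linarith
  have hlp0 : 0 < l ^ p := pow_pos hl0 p
  set κ := θ / l ^ p with hκ
  have hκ0 : 0 ≤ κ := div_nonneg hθ0 hlp0.le
  have hκ1 : κ < 1 := (div_lt_one hlp0).2 hlp
  refine ⟨(1 / ε) ^ p / (1 - κ), div_pos (by positivity) (by linarith), ?_⟩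
  intro Z R A D hR hD hZ
  set c := (1 / ε) ^ p / (1 - κ) with hc
  have hcκ : c * (1 - κ) = (1 / ε) ^ p := div_mul_cancel₀ _ (by linarith)
  have hs : ∀ i : ℕ, R ≤ R * (2 - l ^ i) ∧ R * (2 - l ^ i) ≤ 2 * R := by
    intro i
    have h1 : l ^ i ≤ 1 := pow_le_one₀ hl0.le hl1.le
    have h2 : 0 ≤ l ^ i := by positivity
    constructor <;> nlinarith
  have hind : ∀ i : ℕ, Z R ≤ θ ^ i * Z (R * (2 - l ^ i)) + c * A * (1 - κ ^ i) := by
    intro i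
    induction i with
    | zero => norm_num
    | succ i ih =>
      have hli : 0 < l ^ i := pow_pos hl0 i
      have hdiff : R * (2 - l ^ (i + 1)) - R * (2 - l ^ i) = R * (l ^ i * ε) := by
        rw [pow_succ, hl]; ring
      have h1 := hZ (R * (2 - l ^ i)) (R * (2 - l ^ (i + 1))) (hs i).1
        (by have : 0 < R * (l ^ i * ε) := by positivity
            linarith) (hs (i + 1)).2
      have h2 : R / (R * (2 - l ^ (i + 1)) - R * (2 - l ^ i)) = 1 / ε * (1 / l ^ i) := by
        rw [hdiff]; field_simp
      rw [h2, mul_pow] at h1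
      have h3 : θ ^ i * (1 / l ^ i) ^ p = κ ^ i := by
        rw [hκ, div_pow, div_pow, one_pow, ← pow_mul, ← pow_mul, mul_comm p i]
        ring
      have h4 := mul_le_mul_of_nonneg_left h1 (pow_nonneg hθ0 i)
      calc Z R ≤ θ ^ i * Z (R * (2 - l ^ i)) + c * A * (1 - κ ^ i) := ih
        _ ≤ θ ^ i * (θ * Z (R * (2 - l ^ (i + 1))) + A * ((1 / ε) ^ p * (1 / l ^ i) ^ p)) +
            c * A * (1 - κ ^ i) := by linarith
        _ = θ ^ (i + 1) * Z (R * (2 - l ^ (i + 1))) +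
            A * (1 / ε) ^ p * (θ ^ i * (1 / l ^ i) ^ p) + c * A * (1 - κ ^ i) := by ring
        _ = θ ^ (i + 1) * Z (R * (2 - l ^ (i + 1))) + c * A * (1 - κ ^ (i + 1)) := by
            rw [h3, ← hcκ]; ring
  -- The a priori bound `D` is only needed to be finite: its weight `θ^i` tends to 0, so it leaves
  -- no trace in the constant.
  have hlim : Tendsto (fun i : ℕ => θ ^ i * D + c * A * (1 - κ ^ i)) atTop
      (𝓝 (0 * D + c * A * (1 - 0))) :=
    ((tendsto_pow_atTop_nhds_zero_of_lt_one hθ0 hθ1).mul_const D).add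
      (((tendsto_pow_atTop_nhds_zero_of_lt_one hκ0 hκ1).const_sub 1).const_mul (c * A))
  have hfin := ge_of_tendsto' hlim fun i => (hind i).trans
    (add_le_add_left (mul_le_mul_of_nonneg_left (hD _ (hs i).1 (hs i).2) (pow_nonneg hθ0 i)) _)
  simpa using hfin

end Iteration

/-! ### The hole-filling inequality. -/

section Caccioppoli

variable {n N : ℕ} {Ω : Set (Vec n)} {φ : ℝ → ℝ} {f : Mat N n → ℝ} {k K L c₀ c₁ : ℝ}
  {u : Vec n → Vec N} {G : Vec n → Mat N n}

/-- The constant of the hole-filling inequality. -/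
noncomputable def holeConst (L c₀ M : ℝ) (m : ℕ) : ℝ :=
  2 * (|L| * (3 / c₀ + 6)) * (32 * M) ^ (m + 2)

theorem holeConst_nonneg (hc₀ : 0 < c₀) {M : ℝ} (hM : 1 ≤ M) (m : ℕ) (L : ℝ) :
    0 ≤ holeConst L c₀ M m := by
  have : 0 ≤ 32 * M := by linarith
  unfold holeConst
  positivity

/-- Monotonicity replaces `|X|+|Y|` and `|Y|` by `2M(g+h)`. Then `t φ_a'(t)` is traded for `φ_a(t)`,
the factor `2M` is pulled out and the sum is split; these cost `2`, `4M` and `4` to the power `m+2`,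
whence `32M`. -/
theorem IsAdmissibleIntegrand.second_difference_le_shifted
    (hf : IsAdmissibleIntegrand Ω φ f k K L) (hφ : IsRegularNFunction φ c₀ c₁) (hc₀ : 0 < c₀)
    {m : ℕ} (hm : 1 ≤ m * c₀) {M : ℝ} (hM : 1 ≤ M) (Q : Mat N n) {X Y : Mat N n} {g h : ℝ}
    (hg : 0 ≤ g) (hh : 0 ≤ h) (hX : ‖X‖ ≤ M * (g + h)) (hY : ‖Y‖ ≤ M * (g + h)) :
    f (Q + X) - f Q - f (Q + X + Y) + f (Q + Y) ≤
      holeConst L c₀ M m * (shifted φ ‖Q‖ g + shifted φ ‖Q‖ h) := by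
  have hQ := norm_nonneg Q
  have hgh : 0 ≤ g + h := by positivity
  have hN := hφ.isNFunction
  have h1 : shiftedDeriv φ ‖Q‖ (‖X‖ + ‖Y‖) * ‖Y‖ ≤
      (32 * M) ^ (m + 2) * (shifted φ ‖Q‖ g + shifted φ ‖Q‖ h) := by
    calc shiftedDeriv φ ‖Q‖ (‖X‖ + ‖Y‖) * ‖Y‖
        ≤ shiftedDeriv φ ‖Q‖ (2 * M * (g + h)) * (2 * M * (g + h)) := by
          refine mul_le_mul (hN.shiftedDeriv_mono hQ (by positivity) (by linarith)) ?_
            (norm_nonneg Y) (hN.shiftedDeriv_nonneg hQ (by positivity))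
          have : 0 ≤ M * (g + h) := by positivity
          linarith
      _ = (2 * M * (g + h)) * shiftedDeriv φ ‖Q‖ (2 * M * (g + h)) := mul_comm _ _
      _ ≤ 2 ^ (m + 2) * shifted φ ‖Q‖ (2 * M * (g + h)) :=
          hφ.mul_shiftedDeriv_le hm hQ (by positivity)
      _ ≤ 2 ^ (m + 2) * ((2 * (2 * M)) ^ (m + 2) * shifted φ ‖Q‖ (g + h)) := by
          refine mul_le_mul_of_nonneg_left ?_ (by positivity)
          exact hφ.shifted_mul_le hm hQ (by linarith) hgh
      _ ≤ 2 ^ (m + 2) * ((2 * (2 * M)) ^ (m + 2) *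
            (4 ^ (m + 2) * (shifted φ ‖Q‖ g + shifted φ ‖Q‖ h))) := by
          refine mul_le_mul_of_nonneg_left ?_ (by positivity)
          refine mul_le_mul_of_nonneg_left ?_ (by positivity)
          exact hφ.shifted_add_le hm hQ hg hh
      _ = (32 * M) ^ (m + 2) * (shifted φ ‖Q‖ g + shifted φ ‖Q‖ h) := by
          rw [← mul_assoc, ← mul_assoc, ← mul_pow, ← mul_pow]; congr 2; ring
  refine (hf.second_difference_le hφ hc₀ Q X Y).trans ?_
  rw [holeConst, mul_assoc, mul_assoc (2 * (|L| * (3 / c₀ + 6)))]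
  exact mul_le_mul_of_nonneg_left h1 (by positivity)

/-- One domination criterion for every field that occurs: `∇u - Q`, `X`, `Y`, the rescaled `w` and
the competitor with its gradient are all bounded by a multiple of `1 + |∇u| + |u|`. -/
theorem MemSobolevOrliczLoc.integrableOn_shifted (h : MemSobolevOrliczLoc Ω φ u G)
    (hφ : IsRegularNFunction φ c₀ c₁) (hc₀ : 0 < c₀) {S : Set (Vec n)} (hS : IsCompact S)
    (hSΩ : S ⊆ Ω) {E : Type*} [NormedAddCommGroup E] {F : Vec n → E}
    (hF : AEStronglyMeasurable F (volume.restrict S)) {A : ℝ} (hA : 0 ≤ A)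
    (hb : ∀ x ∈ S, ‖F x‖ ≤ A * (1 + ‖G x‖ + ‖u x‖)) {a : ℝ} (ha : 0 ≤ a) :
    IntegrableOn (fun x => shifted φ a ‖F x‖) S := by
  have hN := hφ.isNFunction
  obtain ⟨m, hm⟩ := exists_nat_ge (1 / c₀)
  rw [div_le_iff₀ hc₀] at hm
  obtain ⟨C, hC, hCb⟩ := hφ.exists_shifted_le hc₀ ha
  have hSfin : IsFiniteMeasure (volume.restrict S) :=
    ⟨by rw [Measure.restrict_apply_univ]; exact hS.measure_lt_top⟩
  have hmajor : IntegrableOn (fun x => C * (1 + (2 * (A + 1)) ^ (m + 2) * (4 ^ (m + 2) *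
      (4 ^ (m + 2) * (shifted φ 0 1 + φ ‖G x‖) + φ ‖u x‖)))) S := by
    have i1 := h.integrableOn S hS hSΩ
    have i2 := h.integrableOn_grad S hS hSΩ
    exact ((integrable_const (1 : ℝ)).add (((((((integrable_const (shifted φ 0 1)).add
      i2).const_mul _).add i1).const_mul _)).const_mul _)).const_mul C
  refine Integrable.mono' hmajor
    ((hN.continuous_shifted_norm ha).comp_aestronglyMeasurable hF) ?_
  filter_upwards [ae_restrict_mem hS.measurableSet] with x hx
  have hg := norm_nonneg (G x)
  have hu := norm_nonneg (u x)
  rw [Real.norm_of_nonneg (hN.shifted_nonneg ha (norm_nonneg _))]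
  refine (hCb _ (norm_nonneg _)).1.trans ?_
  refine mul_le_mul_of_nonneg_left (add_le_add_right ?_ 1) hC
  rw [← hφ.shifted_zero_eq hg, ← hφ.shifted_zero_eq hu]
  calc shifted φ 0 ‖F x‖ ≤ shifted φ 0 ((A + 1) * (1 + ‖G x‖ + ‖u x‖)) := by
        refine hN.shifted_mono le_rfl (norm_nonneg _) ((hb x hx).trans ?_)
        gcongr; linarith
    _ ≤ (2 * (A + 1)) ^ (m + 2) * shifted φ 0 (1 + ‖G x‖ + ‖u x‖) :=
        hφ.shifted_mul_le hm le_rfl (by linarith) (by positivity)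
    _ ≤ _ := by
        refine mul_le_mul_of_nonneg_left ?_ (by positivity)
        refine (hφ.shifted_add_le hm le_rfl (by positivity) hu).trans ?_
        refine mul_le_mul_of_nonneg_left (add_le_add_left ?_ _) (by positivity)
        exact hφ.shifted_add_le hm le_rfl zero_le_one hg

theorem IsAdmissibleIntegrand.integrableOn_comp_add (hf : IsAdmissibleIntegrand Ω φ f k K L)
    (hφ : IsRegularNFunction φ c₀ c₁) (hc₀ : 0 < c₀) (Q : Mat N n) {S : Set (Vec n)}
    (hS : volume S ≠ ⊤) {F : Vec n → Mat N n} (hF : AEStronglyMeasurable F (volume.restrict S))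
    (hi : IntegrableOn (fun x => shifted φ 0 ‖F x‖) S) :
    IntegrableOn (fun x => f (Q + F x)) S := by
  have hSfin : IsFiniteMeasure (volume.restrict S) :=
    ⟨by rw [Measure.restrict_apply_univ]; exact hS.lt_top⟩
  obtain ⟨C, -, hC⟩ := hf.exists_growth hφ hc₀ Q
  have hc : Continuous fun P => f (Q + P) := by
    have := hf.contDiff_one.continuous
    fun_prop
  exact Integrable.mono' (((integrable_const (1 : ℝ)).add hi).const_mul C)
    (hc.comp_aestronglyMeasurable hF) (ae_of_all _ fun x => hC _)

theorem exists_affine_bound (u : Vec n → Vec N) (G : Vec n → Mat N n) {S : Set (Vec n)}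
    (hS : IsCompact S) (Q : Mat N n) (b : Vec N) :
    ∃ A : ℝ, 0 ≤ A ∧ ∀ x ∈ S, ‖G x - Q‖ ≤ A * (1 + ‖G x‖ + ‖u x‖) ∧
      ‖u x - linPoly Q b x‖ ≤ A * (1 + ‖G x‖ + ‖u x‖) := by
  obtain ⟨B, hB⟩ := hS.exists_bound_of_continuousOn (continuous_linPoly Q b).continuousOn
  refine ⟨1 + ‖Q‖ + |B|, by positivity, fun x hx => ⟨?_, ?_⟩⟩
  · have h1 := norm_sub_le (G x) Q
    have h2 : 0 ≤ ‖u x‖ + |B| * (1 + ‖G x‖ + ‖u x‖) + ‖Q‖ * (‖G x‖ + ‖u x‖) + 1 := by positivity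
    linarith
  · have h1 := norm_sub_le (u x) (linPoly Q b x)
    have h3 := (hB x hx).trans (le_abs_self B)
    have h2 : 0 ≤ ‖G x‖ + ‖Q‖ * (1 + ‖G x‖ + ‖u x‖) + |B| * (‖G x‖ + ‖u x‖) + 1 := by positivity
    linarith

/-- Reconciles minimality, which lives on compact sets, with quasiconvexity, which lives on open
balls. -/
theorem closedBall_ae_eq_ball (x₀ : Vec n) {t : ℝ} (ht : 0 < t) :
    Metric.closedBall x₀ t =ᵐ[volume] Metric.ball x₀ t := by
  refine (ae_eq_of_subset_of_measure_ge Metric.ball_subset_closedBall ?_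
    Metric.isOpen_ball.measurableSet.nullMeasurableSet measure_closedBall_lt_top.ne).symm
  rw [← Metric.ball_union_sphere]
  refine (measure_union_le _ _).trans ?_
  rw [Measure.addHaar_sphere_of_ne_zero _ _ ht.ne', add_zero]

set_option maxHeartbeats 1000000 in
/-- The hole-filling inequality for local minimizers. -/
theorem IsLocalMinimizer.hole_filling (hu : IsLocalMinimizer Ω φ f u G) (hΩ : IsOpen Ω)
    (hf : IsAdmissibleIntegrand Ω φ f k K L) (hφ : IsRegularNFunction φ c₀ c₁) (hk : 0 < k)
    (hc₀ : 0 < c₀) {m : ℕ} (hm : 1 ≤ m * c₀) {M : ℝ} (hM : 1 ≤ M) {x₀ : Vec n} {s t : ℝ}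
    (hs : 0 < s) (hst : s < t) (ht : Metric.closedBall x₀ t ⊆ Ω) {η : Vec n → ℝ}
    (hη : ContDiff ℝ ∞ η) (hη01 : ∀ x, 0 ≤ η x ∧ η x ≤ 1) (hη1 : ∀ x ∈ Metric.ball x₀ s, η x = 1)
    (hηs : tsupport η ⊆ Metric.closedBall x₀ ((s + t) / 2))
    (hηd : ∀ x, ‖fderiv ℝ η x‖ ≤ M / (t - s)) (Q : Mat N n) (b : Vec N) :
    k * ∫ x in Metric.ball x₀ s, shifted φ ‖Q‖ ‖G x - Q‖ ≤
      holeConst L c₀ M m * ∫ x in Metric.ball x₀ t \ Metric.ball x₀ s,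
        (shifted φ ‖Q‖ ‖G x - Q‖ +
          shifted φ ‖Q‖ (‖u x - linPoly Q b x‖ / (t - s))) := by
  have hN := hφ.isNFunction
  have hd : 0 < t - s := by linarith
  have ht0 : 0 < t := hs.trans hst
  set w : Vec n → Vec N := fun x => u x - linPoly Q b x with hw
  set W : Vec n → Mat N n := fun x => G x - Q with hW
  have hweak : HasWeakGradient Ω w W :=
    hu.mem.hasWeakGradient.sub (hasWeakGradient_linPoly Ω Q b)
  have hrt : Metric.closedBall x₀ ((s + t) / 2) ⊆ Metric.closedBall x₀ t :=
    Metric.closedBall_subset_closedBall (by linarith)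
  have hηc : HasCompactSupport η :=
    (isCompact_closedBall x₀ _).of_isClosed_subset (isClosed_tsupport _) hηs
  have hηΩ : tsupport η ⊆ Ω := hηs.trans (hrt.trans ht)
  -- `X` and `Y` are the gradients of `ηw` and `(1-η)w`, so `Q + X + Y = ∇u`.
  set ξ : Vec n → Vec N := fun x => η x • w x with hξdef
  set X : Vec n → Mat N n := fun x => η x • W x + outer (w x) (gradient η x) with hXdef
  set Y : Vec n → Mat N n := fun x => W x - X x with hYdef
  have hξ : HasWeakGradient univ ξ X := hweak.smul hη hηc hηΩ
  have hXm : AEStronglyMeasurable X volume :=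
    (hweak.integrable_smul_add_outer hη hηc hηΩ).aestronglyMeasurable
  have hη0 : ∀ x, x ∉ Metric.closedBall x₀ ((s + t) / 2) → η x = 0 := fun x hx =>
    image_eq_zero_of_notMem_tsupport fun h => hx (hηs h)
  have hη0' : ∀ x, x ∉ Metric.closedBall x₀ ((s + t) / 2) → gradient η x = 0 := by
    intro x hx
    rw [← norm_eq_zero, norm_gradient, norm_eq_zero]
    exact image_eq_zero_of_notMem_tsupport fun h => hx (hηs (tsupport_fderiv_subset ℝ h))
  have hξ0 : ∀ x, x ∉ Metric.closedBall x₀ ((s + t) / 2) → ξ x = 0 := fun x hx => by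
    simp [hξdef, hη0 x hx]
  have hX0 : ∀ x, x ∉ Metric.closedBall x₀ ((s + t) / 2) → X x = 0 := fun x hx => by
    simp [hXdef, hη0 x hx, hη0' x hx, outer_zero]
  have hXW : ∀ x ∈ Metric.ball x₀ s, X x = W x := by
    intro x hx
    have h1 : η =ᶠ[𝓝 x] fun _ => 1 := by
      filter_upwards [Metric.isOpen_ball.mem_nhds hx] with y hy using hη1 y hy
    have h2 : gradient η x = 0 := by
      rw [← norm_eq_zero, norm_gradient, norm_eq_zero, h1.fderiv_eq]
      simp
    simp [hXdef, hη1 x hx, h2, outer_zero]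
  have houter : ∀ x, ‖outer (w x) (gradient η x)‖ ≤ M * (‖w x‖ / (t - s)) := by
    intro x
    rw [norm_outer, norm_gradient]
    calc ‖w x‖ * ‖fderiv ℝ η x‖ ≤ ‖w x‖ * (M / (t - s)) := by gcongr; exact hηd x
      _ = _ := by ring
  have hXb : ∀ x, ‖X x‖ ≤ M * (‖W x‖ + ‖w x‖ / (t - s)) := by
    intro x
    have h1 : ‖η x • W x‖ ≤ M * ‖W x‖ := by
      rw [norm_smul, Real.norm_of_nonneg (hη01 x).1]
      gcongr
      exact (hη01 x).2.trans hM
    have := (norm_add_le (η x • W x) (outer (w x) (gradient η x))).trans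
      (add_le_add h1 (houter x))
    linarith
  have hYb : ∀ x, ‖Y x‖ ≤ M * (‖W x‖ + ‖w x‖ / (t - s)) := by
    intro x
    have h0 : Y x = (1 - η x) • W x - outer (w x) (gradient η x) := by
      simp only [hYdef, hXdef, sub_smul, one_smul]; abel
    have h1 : ‖(1 - η x) • W x‖ ≤ M * ‖W x‖ := by
      rw [norm_smul, Real.norm_of_nonneg (by linarith [(hη01 x).2])]
      gcongr
      linarith [(hη01 x).1]
    rw [h0]
    have := (norm_sub_le ((1 - η x) • W x) (outer (w x) (gradient η x))).trans
      (add_le_add h1 (houter x))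
    linarith
  have hmeas : ∀ {S : Set (Vec n)}, IsCompact S → S ⊆ Ω →
      AEStronglyMeasurable W (volume.restrict S) ∧
      AEStronglyMeasurable w (volume.restrict S) := fun hS hSΩ =>
    ⟨(hweak.locallyIntegrableOn_grad.integrableOn_compact_subset hSΩ hS).aestronglyMeasurable,
      (hweak.locallyIntegrableOn.integrableOn_compact_subset hSΩ hS).aestronglyMeasurable⟩
  have hbound : ∀ {S : Set (Vec n)}, IsCompact S → ∃ A : ℝ, 0 ≤ A ∧ ∀ x ∈ S,
      ‖W x‖ ≤ A * (1 + ‖G x‖ + ‖u x‖) ∧ ‖w x‖ / (t - s) ≤ A * (1 + ‖G x‖ + ‖u x‖) ∧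
      ‖X x‖ ≤ A * (1 + ‖G x‖ + ‖u x‖) ∧ ‖Y x‖ ≤ A * (1 + ‖G x‖ + ‖u x‖) ∧
      ‖G x - X x‖ ≤ A * (1 + ‖G x‖ + ‖u x‖) ∧ ‖u x - ξ x‖ ≤ A * (1 + ‖G x‖ + ‖u x‖) := by
    intro S hS
    obtain ⟨A, hA, hb⟩ := exists_affine_bound u G hS Q b
    refine ⟨1 + A + M * (A + A / (t - s)), by positivity, fun x hx => ?_⟩
    obtain ⟨h1, h2⟩ := hb x hx
    have hT : 0 ≤ ‖G x‖ + ‖u x‖ := by positivity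
    set T := 1 + ‖G x‖ + ‖u x‖ with hTdef
    have hT0 : 0 ≤ T := by positivity
    have h3 : ‖w x‖ / (t - s) ≤ A / (t - s) * T := by
      rw [div_mul_eq_mul_div]; gcongr
    have h4 : M * (‖W x‖ + ‖w x‖ / (t - s)) ≤ M * (A + A / (t - s)) * T := by
      rw [mul_assoc, add_mul]; gcongr
    have h5 := (hXb x).trans h4
    have h6 := (hYb x).trans h4
    have h7 : 0 ≤ A * T := by positivity
    have h8 : 0 ≤ M * (A + A / (t - s)) * T := by positivity
    have h9 : A / (t - s) * T ≤ M * (A + A / (t - s)) * T := by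
      gcongr
      have : 0 ≤ A / (t - s) := by positivity
      nlinarith
    have h10 : ‖ξ x‖ ≤ A * T := by
      refine le_trans ?_ h2
      rw [hξdef, norm_smul, Real.norm_of_nonneg (hη01 x).1]
      exact mul_le_of_le_one_left (norm_nonneg _) (hη01 x).2
    have h11 := norm_sub_le (G x) (X x)
    have h12 := norm_sub_le (u x) (ξ x)
    have hg := norm_nonneg (G x)
    have hu' := norm_nonneg (u x)
    have hexp : (1 + A + M * (A + A / (t - s))) * T =
        T + A * T + M * (A + A / (t - s)) * T := by ring
    rw [hexp]
    refine ⟨?_, ?_, ?_, ?_, ?_, ?_⟩ <;> linarith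
  -- integrability on the closed ball
  set S := Metric.closedBall x₀ t with hSdef
  have hS : IsCompact S := isCompact_closedBall x₀ t
  have hSfin : volume S ≠ ⊤ := hS.measure_lt_top.ne
  have hball : Metric.ball x₀ t ⊆ S := Metric.ball_subset_closedBall
  have hae : S =ᵐ[volume] Metric.ball x₀ t := closedBall_ae_eq_ball x₀ ht0
  obtain ⟨hWm, hwm⟩ := hmeas hS ht
  obtain ⟨A, hA, hAb⟩ := hbound hS
  have hint : ∀ {E : Type} [NormedAddCommGroup E] {F : Vec n → E} {a : ℝ}, 0 ≤ a →
      AEStronglyMeasurable F (volume.restrict S) →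
      (∀ x ∈ S, ‖F x‖ ≤ A * (1 + ‖G x‖ + ‖u x‖)) →
      IntegrableOn (fun x => shifted φ a ‖F x‖) S := fun ha hF hb =>
    hu.mem.integrableOn_shifted hφ hc₀ hS ht hF hA hb ha
  have hYm : AEStronglyMeasurable Y (volume.restrict S) := hWm.sub hXm.restrict
  have iW : IntegrableOn (fun x => shifted φ ‖Q‖ ‖W x‖) S :=
    hint (norm_nonneg Q) hWm fun x hx => (hAb x hx).1
  have iw : IntegrableOn (fun x => shifted φ ‖Q‖ (‖w x‖ / (t - s))) S := by
    have := hint (F := fun x => (t - s)⁻¹ • w x) (norm_nonneg Q) (hwm.const_smul (t - s)⁻¹)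
      fun x hx => by
        rw [norm_smul, Real.norm_of_nonneg (inv_nonneg.2 hd.le), inv_mul_eq_div]
        exact (hAb x hx).2.1
    refine this.congr_fun (fun x _ => ?_) hS.measurableSet
    simp only
    rw [norm_smul, Real.norm_of_nonneg (inv_nonneg.2 hd.le), inv_mul_eq_div]
  have iX : ∀ {a : ℝ}, 0 ≤ a → IntegrableOn (fun x => shifted φ a ‖X x‖) S := fun ha =>
    hint ha hXm.restrict fun x hx => (hAb x hx).2.2.1
  have iY : IntegrableOn (fun x => shifted φ 0 ‖Y x‖) S :=
    hint le_rfl hYm fun x hx => (hAb x hx).2.2.2.1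
  have ifX : IntegrableOn (fun x => f (Q + X x)) S :=
    hf.integrableOn_comp_add hφ hc₀ Q hSfin hXm.restrict (iX le_rfl)
  have ifY : IntegrableOn (fun x => f (Q + Y x)) S :=
    hf.integrableOn_comp_add hφ hc₀ Q hSfin hYm iY
  have ifG : IntegrableOn (fun x => f (G x)) S := by
    have := hf.integrableOn_comp_add hφ hc₀ Q hSfin hWm
      (hint le_rfl hWm fun x hx => (hAb x hx).1)
    simpa [hW] using this
  -- the competitor
  have hmem : MemSobolevOrliczLoc Ω φ (fun x => u x - ξ x) (fun x => G x - X x) := by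
    have hwg := hu.mem.hasWeakGradient.sub (hξ.mono Ω)
    refine ⟨hwg, ?_, ?_⟩
    · intro S' hS' hSΩ'
      obtain ⟨A', hA', hb'⟩ := hbound hS'
      have := hu.mem.integrableOn_shifted hφ hc₀ hS' hSΩ'
        (hwg.locallyIntegrableOn.integrableOn_compact_subset hSΩ' hS').aestronglyMeasurable hA'
        (fun x hx => (hb' x hx).2.2.2.2.2) le_rfl
      simpa only [hφ.shifted_zero_eq (norm_nonneg _)] using this
    · intro S' hS' hSΩ'
      obtain ⟨A', hA', hb'⟩ := hbound hS'
      have := hu.mem.integrableOn_shifted hφ hc₀ hS' hSΩ'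
        (hwg.locallyIntegrableOn_grad.integrableOn_compact_subset hSΩ' hS').aestronglyMeasurable
        hA' (fun x hx => (hb' x hx).2.2.2.2.1) le_rfl
      simpa only [hφ.shifted_zero_eq (norm_nonneg _)] using this
  have hmin : ∫ x in S, f (G x) ≤ ∫ x in S, f (Q + Y x) := by
    have h1 := hu.minimal S hS ht _ _ hmem
      (ae_restrict_of_forall_mem (hΩ.measurableSet.diff hS.measurableSet) fun x hx => by
        rw [hξ0 x fun h => hx.2 (hrt h), sub_zero])
    refine h1.trans_eq ?_
    congr 1; ext x
    congr 1
    simp only [hYdef, hW]; abel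
  -- quasiconvexity
  have hiX : Integrable fun x => shifted φ 0 ‖X x‖ := by
    refine (integrableOn_iff_integrable_of_support_subset ?_).1 (iX le_rfl)
    intro x hx
    by_contra h
    refine hx ?_
    simp only
    rw [hX0 x fun h' => h (hrt h'), norm_zero, shifted_zero]
  -- The support of `η` reaches only to radius `(s+t)/2`, which leaves the room below `t` that
  -- mollification needs.
  have hqc := hf.quasiconvex_weak hφ hc₀ ht0 (by linarith) (hball.trans ht) Q hξ hξ0 hX0 hiX
  have hsub : Metric.ball x₀ s ⊆ Metric.ball x₀ t := Metric.ball_subset_ball hst.le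
  have hleft : ∫ x in Metric.ball x₀ s, shifted φ ‖Q‖ ‖W x‖ ≤
      ∫ x in Metric.ball x₀ t, shifted φ ‖Q‖ ‖X x‖ := by
    calc ∫ x in Metric.ball x₀ s, shifted φ ‖Q‖ ‖W x‖
        = ∫ x in Metric.ball x₀ s, shifted φ ‖Q‖ ‖X x‖ :=
          setIntegral_congr_fun Metric.isOpen_ball.measurableSet fun x hx => by
            simp only [hXW x hx]
      _ ≤ _ := setIntegral_mono_set ((iX (norm_nonneg Q)).mono_set hball)
          (ae_of_all _ fun x => hN.shifted_nonneg (norm_nonneg Q) (norm_nonneg _))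
          hsub.eventuallyLE
  rw [setIntegral_congr_set hae, setIntegral_congr_set hae] at hmin
  have iQ : IntegrableOn (fun _ : Vec n => f Q) (Metric.ball x₀ t) :=
    integrableOn_const measure_ball_lt_top.ne
  have hsum : ∫ x in Metric.ball x₀ t,
        (f (Q + X x) - f Q - f (Q + X x + Y x) + f (Q + Y x)) =
      (∫ x in Metric.ball x₀ t, (f (Q + X x) - f Q)) - (∫ x in Metric.ball x₀ t, f (G x)) +
        ∫ x in Metric.ball x₀ t, f (Q + Y x) := by
    have e : ∀ x, Q + X x + Y x = G x := fun x => by simp only [hYdef, hW]; abel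
    simp only [e]
    have j1 : IntegrableOn (fun x => f (Q + X x) - f Q) (Metric.ball x₀ t) :=
      (ifX.mono_set hball).sub iQ
    have j2 : IntegrableOn (fun x => f (Q + X x) - f Q - f (G x)) (Metric.ball x₀ t) :=
      j1.sub (ifG.mono_set hball)
    rw [← integral_sub j1 (ifG.mono_set hball), ← integral_add j2 (ifY.mono_set hball)]
  -- On the inner ball `Y = 0` and the second difference vanishes identically: this creates the
  -- hole.
  have hhole : ∫ x in Metric.ball x₀ t,
        (f (Q + X x) - f Q - f (Q + X x + Y x) + f (Q + Y x)) =
      ∫ x in Metric.ball x₀ t \ Metric.ball x₀ s,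
        (f (Q + X x) - f Q - f (Q + X x + Y x) + f (Q + Y x)) := by
    refine setIntegral_eq_of_subset_of_forall_sdiff_eq_zero Metric.isOpen_ball.measurableSet
      sdiff_subset fun x hx => ?_
    have hx' : x ∈ Metric.ball x₀ s := by
      by_contra h; exact hx.2 ⟨hx.1, h⟩
    have : Y x = 0 := by simp only [hYdef, hXW x hx', sub_self]
    simp [this]
  have hdS : Metric.ball x₀ t \ Metric.ball x₀ s ⊆ S := sdiff_subset.trans hball
  have hpt : ∫ x in Metric.ball x₀ t \ Metric.ball x₀ s,
        (f (Q + X x) - f Q - f (Q + X x + Y x) + f (Q + Y x)) ≤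
      ∫ x in Metric.ball x₀ t \ Metric.ball x₀ s, holeConst L c₀ M m *
        (shifted φ ‖Q‖ ‖W x‖ + shifted φ ‖Q‖ (‖w x‖ / (t - s))) := by
    refine integral_mono ?_ (((iW.mono_set hdS).add (iw.mono_set hdS)).const_mul _) fun x => ?_
    · have e : ∀ x, Q + X x + Y x = G x := fun x => by simp only [hYdef, hW]; abel
      simp only [e]
      exact (((ifX.mono_set hdS).sub (iQ.mono_set sdiff_subset)).sub (ifG.mono_set hdS)).add
        (ifY.mono_set hdS)
    · exact hf.second_difference_le_shifted hφ hc₀ hm hM Q (norm_nonneg _) (by positivity)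
        (hXb x) (hYb x)
  rw [integral_const_mul] at hpt
  have := mul_le_mul_of_nonneg_left hleft hk.le
  linarith

end Caccioppoli

/-! ### The Caccioppoli estimate. -/

section Caccioppoli

variable {n N : ℕ} {Ω : Set (Vec n)} {φ : ℝ → ℝ} {c₀ c₁ : ℝ}
  {u : Vec n → Vec N} {G : Vec n → Mat N n}

theorem MemSobolevOrliczLoc.integrableOn_shifted_affine (h : MemSobolevOrliczLoc Ω φ u G)
    (hφ : IsRegularNFunction φ c₀ c₁) (hc₀ : 0 < c₀) {S : Set (Vec n)} (hS : IsCompact S)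
    (hSΩ : S ⊆ Ω) (Q : Mat N n) (b : Vec N) {d : ℝ} (hd : 0 < d) :
    IntegrableOn (fun x => shifted φ ‖Q‖ ‖G x - Q‖) S ∧
      IntegrableOn (fun x => shifted φ ‖Q‖ (‖u x - linPoly Q b x‖ / d)) S := by
  obtain ⟨A, hA, hb⟩ := exists_affine_bound u G hS Q b
  have hweak := h.hasWeakGradient.sub (hasWeakGradient_linPoly Ω Q b)
  have hW := (hweak.locallyIntegrableOn_grad.integrableOn_compact_subset hSΩ
    hS).aestronglyMeasurable
  have hw := (hweak.locallyIntegrableOn.integrableOn_compact_subset hSΩ hS).aestronglyMeasurable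
  refine ⟨h.integrableOn_shifted hφ hc₀ hS hSΩ hW hA (fun x hx => (hb x hx).1) (norm_nonneg Q), ?_⟩
  have hnorm : ∀ x, ‖d⁻¹ • (u x - linPoly Q b x)‖ = ‖u x - linPoly Q b x‖ / d := fun x => by
    rw [norm_smul, Real.norm_of_nonneg (inv_nonneg.2 hd.le), inv_mul_eq_div]
  have := h.integrableOn_shifted (F := fun x => d⁻¹ • (u x - linPoly Q b x)) (A := A / d)
    hφ hc₀ hS hSΩ (hw.const_smul d⁻¹) (by positivity)
    (fun x hx => by
      rw [hnorm, div_mul_eq_mul_div]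
      gcongr
      exact (hb x hx).2) (norm_nonneg Q)
  simpa only [hnorm] using this

end Caccioppoli

theorem theorem3p2 (n N : ℕ) (k K L c₀ c₁ : ℝ) (hk : 0 < k) (hc₀ : 0 < c₀) :
    ∃ c : ℝ, 0 < c ∧
      ∀ φ : ℝ → ℝ, IsRegularNFunction φ c₀ c₁ →
      ∀ Ω : Set (Vec n), IsOpen Ω →
      ∀ f : Mat N n → ℝ, IsAdmissibleIntegrand Ω φ f k K L →
      ∀ (u : Vec n → Vec N) (G : Vec n → Mat N n), IsLocalMinimizer Ω φ f u G →
      ∀ (x₀ : Vec n) (R : ℝ), 0 < R → Metric.closedBall x₀ (2 * R) ⊆ Ω →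
      ∀ (Q : Mat N n) (b : Vec N),
        IntegrableOn (fun x => shifted φ ‖Q‖ ‖G x - Q‖) (Metric.ball x₀ R) volume ∧
        IntegrableOn (fun x => shifted φ ‖Q‖ (‖u x - linPoly Q b x‖ / R))
          (Metric.ball x₀ (2 * R)) volume ∧
        ∫ x in Metric.ball x₀ R, shifted φ ‖Q‖ ‖G x - Q‖ ≤
          c * ∫ x in Metric.ball x₀ (2 * R), shifted φ ‖Q‖ (‖u x - linPoly Q b x‖ / R) := by
  obtain ⟨m, hm⟩ := exists_nat_ge (1 / c₀)
  rw [div_le_iff₀ hc₀] at hm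
  obtain ⟨M, hM, hcut⟩ := exists_cutoff
  -- The cutoff acts between `s` and `(s+t)/2`; halving the gap doubles its gradient bound, hence `2
  -- * M`.
  set C := holeConst L c₀ (2 * M) m with hC
  have hC0 : 0 ≤ C := holeConst_nonneg hc₀ (by linarith) m L
  set θ := C / (k + C) with hθ
  have hkC : 0 < k + C := by linarith
  have hθ0 : 0 ≤ θ := by positivity
  have hθ1 : θ < 1 := (div_lt_one hkC).2 (by linarith)
  obtain ⟨c, hc, hiter⟩ := exists_iteration_bound hθ0 hθ1 (m + 2)
  -- The summand 1 only secures positivity, since `θ = 0` when `L = 0`.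
  refine ⟨c * (θ * 2 ^ (m + 2)) + 1, by positivity, ?_⟩
  intro φ hφ Ω hΩ f hf u G hu x₀ R hR hball Q b
  have hN := hφ.isNFunction
  have hQ := norm_nonneg Q
  have hint : ∀ {d : ℝ}, 0 < d → _ := fun hd => hu.mem.integrableOn_shifted_affine hφ hc₀
    (isCompact_closedBall x₀ (2 * R)) hball Q b hd
  have hsub : ∀ {t}, t ≤ 2 * R → Metric.ball x₀ t ⊆ Metric.closedBall x₀ (2 * R) := fun ht =>
    Metric.ball_subset_closedBall.trans (Metric.closedBall_subset_closedBall ht)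
  have hZi : ∀ {t}, t ≤ 2 * R →
      IntegrableOn (fun x => shifted φ ‖Q‖ ‖G x - Q‖) (Metric.ball x₀ t) := fun ht =>
    (hint hR).1.mono_set (hsub ht)
  have hVi : ∀ {d t : ℝ}, 0 < d → t ≤ 2 * R →
      IntegrableOn (fun x => shifted φ ‖Q‖ (‖u x - linPoly Q b x‖ / d)) (Metric.ball x₀ t) :=
    fun hd ht => (hint hd).2.mono_set (hsub ht)
  have hZ0 : ∀ x, 0 ≤ shifted φ ‖Q‖ ‖G x - Q‖ := fun x => hN.shifted_nonneg hQ (norm_nonneg _)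
  have hV0 : ∀ {d : ℝ}, 0 < d → ∀ x, 0 ≤ shifted φ ‖Q‖ (‖u x - linPoly Q b x‖ / d) :=
    fun hd x => hN.shifted_nonneg hQ (by positivity)
  refine ⟨hZi (by linarith), hVi hR le_rfl, ?_⟩
  set V := ∫ x in Metric.ball x₀ (2 * R), shifted φ ‖Q‖ (‖u x - linPoly Q b x‖ / R) with hV
  have hVnn : 0 ≤ V := integral_nonneg (hV0 hR)
  set Z : ℝ → ℝ := fun t => ∫ x in Metric.ball x₀ t, shifted φ ‖Q‖ ‖G x - Q‖ with hZ
  have hstep : ∀ s t, R ≤ s → s < t → t ≤ 2 * R →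
      Z s ≤ θ * Z t + θ * 2 ^ (m + 2) * V * (R / (t - s)) ^ (m + 2) := by
    intro s t hs hst ht
    have hd : 0 < t - s := by linarith
    have hs0 : 0 < s := by linarith
    obtain ⟨η, hη, hη01, hη1, hηs, hηd⟩ := hcut x₀ hs0 (show s < (s + t) / 2 by linarith)
    have hhole := hu.hole_filling hΩ hf hφ hk hc₀ hm (M := 2 * M) (by linarith) hs0 hst
      ((Metric.closedBall_subset_closedBall ht).trans hball) hη hη01 hη1 hηs
      (fun x => (hηd x).trans_eq (by
        rw [show (s + t) / 2 - s = (t - s) / 2 by ring]; field_simp)) Q b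
    have hsplit : ∫ x in Metric.ball x₀ t \ Metric.ball x₀ s,
          (shifted φ ‖Q‖ ‖G x - Q‖ + shifted φ ‖Q‖ (‖u x - linPoly Q b x‖ / (t - s))) =
        (Z t - Z s) + ∫ x in Metric.ball x₀ t \ Metric.ball x₀ s,
          shifted φ ‖Q‖ (‖u x - linPoly Q b x‖ / (t - s)) := by
      rw [integral_add ((hZi ht).mono_set sdiff_subset) ((hVi hd ht).mono_set sdiff_subset),
        setIntegral_sdiff Metric.isOpen_ball.measurableSet (hZi ht)
          (Metric.ball_subset_ball hst.le)]
    have hrest : ∫ x in Metric.ball x₀ t \ Metric.ball x₀ s,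
          shifted φ ‖Q‖ (‖u x - linPoly Q b x‖ / (t - s)) ≤ (2 * (R / (t - s))) ^ (m + 2) * V := by
      calc ∫ x in Metric.ball x₀ t \ Metric.ball x₀ s,
            shifted φ ‖Q‖ (‖u x - linPoly Q b x‖ / (t - s))
          ≤ ∫ x in Metric.ball x₀ (2 * R), shifted φ ‖Q‖ (‖u x - linPoly Q b x‖ / (t - s)) :=
            setIntegral_mono_set (hVi hd le_rfl) (ae_of_all _ (hV0 hd))
              (sdiff_subset.trans (Metric.ball_subset_ball ht)).eventuallyLE
        _ ≤ ∫ x in Metric.ball x₀ (2 * R), (2 * (R / (t - s))) ^ (m + 2) *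
              shifted φ ‖Q‖ (‖u x - linPoly Q b x‖ / R) := by
            refine integral_mono (hVi hd le_rfl) ((hVi hR le_rfl).const_mul _) fun x => ?_
            -- Both radii lie in `[R, 2R]`, so `t - s ≤ R` and the growth bound applies with `l =
            -- R/(t-s)`.
            have h1 : 1 ≤ R / (t - s) := by rw [one_le_div hd]; linarith
            have h2 := hφ.shifted_mul_le hm hQ h1
              (show 0 ≤ ‖u x - linPoly Q b x‖ / R by positivity)
            refine le_trans (le_of_eq ?_) h2
            congr 1
            field_simp
        _ = _ := integral_const_mul _ _
    rw [hsplit] at hhole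
    have h3 : k * Z s ≤ C * (Z t - Z s) + C * ((2 * (R / (t - s))) ^ (m + 2) * V) := by
      have := mul_le_mul_of_nonneg_left hrest hC0
      have h4 : k * Z s ≤ C * ((Z t - Z s) + ∫ x in Metric.ball x₀ t \ Metric.ball x₀ s,
          shifted φ ‖Q‖ (‖u x - linPoly Q b x‖ / (t - s))) := hhole
      linarith
    -- Filling the hole: `C * Z s` moves to the left, and division by `k + C` leaves the factor `θ`.
    have h5 : Z s ≤ C * (Z t + (2 * (R / (t - s))) ^ (m + 2) * V) / (k + C) := by
      rw [le_div_iff₀ hkC]; linarith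
    refine h5.trans_eq ?_
    rw [hθ, mul_pow]
    ring
  have hfin := hiter Z R (θ * 2 ^ (m + 2) * V) (Z (2 * R)) hR
    (fun s _ hs => setIntegral_mono_set (hZi le_rfl) (ae_of_all _ hZ0)
      (Metric.ball_subset_ball hs).eventuallyLE) hstep
  calc Z R ≤ c * (θ * 2 ^ (m + 2) * V) := hfin
    _ ≤ (c * (θ * 2 ^ (m + 2)) + 1) * V := by linarith
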